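/- Let $p>2$ be a prime number. **Notation.** For a finite group $G$ and a subgroup $H\le G$, let $\mathrm{Ind}_H^G\mathbb Z=\{f\colon G\to\mathbb Z \mid f(hg)=f(g)\ \text{for all } h\in H,\ g\in G\}$ with the $G$-action $(g\cdot f)(g')=f(g'g)$, and let $J_{G/H}$ be the cokernel of the $G$-homomorphism $\mathbb Z\to\mathrm{Ind}_H^G\mathbb Z$ sending $1$ to the constant function $1$. For a set $\mathcal D$ of subgroups of $G$ put $$\mathrm{Sha}^2_{\mathcal D}(G,J_{G/H}):=\mathrm{Ker}\Big(H^2(G,J_{G/H})\xrightarrow{(\mathrm{Res}_{G/D})_{D}}\bigoplus_{D\in\mathcal D}H^2(D,J_{G/H})\Big),$$ and write $\mathrm{Sha}^2_\omega(G,J_{G/H})$ when $\mathcal D$ is the set of all cyclic subgroups of $G$. The set $\mathcal D$ is called *admissible* if it contains all cyclic subgroups of $G$ and $gDg^{-1}\in\mathcal D$ for all $g\in G$ and $D\in\mathcal D$. On $\mathbb F_p\times\mathbb F_p$ consider the permutations $\rho_1(i,j)=(i,j+1)$, $\rho_2(i,j)=(i+1,j)$ and, for $i_0\in\mathbb{F}_p$,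 $z_{i_0}(i,j)=(i,j+1)$ if $i=i_0$ and $z_{i_0}(i,j)=(i,j)$ otherwise. For $n\in\{1,\dots,p\}$ let $\gamma_n=\prod_{j=0}^{p-1}z_j^{a_{p-n,j}}$, where $a_{m,j}=(-1)^{m-j}\binom{m}{j}$ if $j\le m$ and $a_{m,j}=0$ if $j>m$, and let $P'_n=\langle\rho_1,\rho_2,\gamma_n\rangle$. **Theorem.** The group $P'_1$ is isomorphic to $(C_p)^2$, and $P'_2$ is isomorphic to the Heisenberg group of upper unitriangular $3\times 3$ matrices over $\mathbb F_p$. Let $G$ be a transitive subgroup of the symmetric group on $\mathbb Z/p^2$ that is a $p$-group, and let $H$ be the stabilizer in $G$ of some point of $\mathbb Z/p^2$. 1. If $\mathrm{Sha}^2_\omega(G,J_{G/H})\ne 0$, then $G\cong P'_n$ for some $n\in\{1,2\}$. 2. Assume $G\cong P'_n$ for some $n\in\{1,2\}$. Then for every admissible set $\mathcal D$ of subgroups of $G$, $$\mathrm{Sha}^2_{\mathcal D}(G,J_{G/H})\cong\begin{cases}0&\text{if some } D\in\mathcal D \text{ contains a subgroup isomorphic to } (C_p)^2,\\ \mathbb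 Z/p&\text{otherwise.}\end{cases}$$ -/

import Mathlib

noncomputable section

/-! ### The permutation groups `P'_n` of `𝔽_p × 𝔽_p` -/

/-- The permutation `z_{i₀}` of `𝔽_p × 𝔽_p`: `(i, j) ↦ (i, j + 1)` if `i = i₀`, and
`(i, j) ↦ (i, j)` otherwise. -/
def zPerm (p : ℕ) (i₀ : ZMod p) : Equiv.Perm (ZMod p × ZMod p) where
  toFun x := if x.1 = i₀ then (x.1, x.2 + 1) else x
  invFun x := if x.1 = i₀ then (x.1, x.2 - 1) else x
  left_inv x := by
    obtain ⟨i, j⟩ := x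
    by_cases h : i = i₀ <;> simp [h]
  right_inv x := by
    obtain ⟨i, j⟩ := x
    by_cases h : i = i₀ <;> simp [h]

/-- The permutation `ρ₁ : (i, j) ↦ (i, j + 1)`. -/
def rho₁ (p : ℕ) : Equiv.Perm (ZMod p × ZMod p) :=
  (Equiv.refl (ZMod p)).prodCongr (Equiv.addRight 1)

/-- The permutation `ρ₂ : (i, j) ↦ (i + 1, j)`. -/
def rho₂ (p : ℕ) : Equiv.Perm (ZMod p × ZMod p) :=
  (Equiv.addRight 1).prodCongr (Equiv.refl (ZMod p))

/-- The integer `a_{i,j} = (-1)^{i-j} (i choose j)` if `j ≤ i`, and `0` if `i < j`. -/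
def aCoeff (i j : ℕ) : ℤ :=
  if j ≤ i then (-1) ^ (i - j) * (i.choose j : ℤ) else 0

/-- The permutation `γ_n = z_0^{a_{p-n,0}} ⋯ z_{p-1}^{a_{p-n,p-1}}`, for `1 ≤ n ≤ p`. -/
def gammaPerm (p n : ℕ) : Equiv.Perm (ZMod p × ZMod p) :=
  ((List.range p).map fun j : ℕ => zPerm p (j : ZMod p) ^ aCoeff (p - n) j).prod

/-- The group `P'_n = ⟨ρ₁, ρ₂, γ_n⟩`, for `1 ≤ n ≤ p`. -/
def PPrime (p n : ℕ) : Subgroup (Equiv.Perm (ZMod p × ZMod p)) :=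
  Subgroup.closure {rho₁ p, rho₂ p, gammaPerm p n}

/-- The Heisenberg group over `𝔽_p`: upper unitriangular `3 × 3` matrices. -/
def heisenberg (p : ℕ) : Subgroup (Matrix.SpecialLinearGroup (Fin 3) (ZMod p)) where
  carrier := {A | ∃ x y z : ZMod p, (A : Matrix (Fin 3) (Fin 3) (ZMod p)) =
    !![1, x, z; 0, 1, y; 0, 0, 1]}
  one_mem' := ⟨0, 0, 0, by
    ext i j; fin_cases i <;> fin_cases j <;> simp⟩
  mul_mem' := by
    rintro A B ⟨x, y, z, hA⟩ ⟨x', y', z', hB⟩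
    refine ⟨x' + x, y' + y, z' + x * y' + z, ?_⟩
    rw [Matrix.SpecialLinearGroup.coe_mul, hA, hB]
    ext i j; fin_cases i <;> fin_cases j <;> simp [Matrix.mul_apply, Fin.sum_univ_three]
  inv_mem' := by
    rintro A ⟨x, y, z, hA⟩
    refine ⟨-x, -y, x * y - z, ?_⟩
    rw [Matrix.SpecialLinearGroup.coe_inv, hA, Matrix.adjugate_fin_three]
    ext i j; fin_cases i <;> fin_cases j <;> simp

/-! ### The lattice `J_{G/H}` and the groups `Ш²` -/

section Cohomology

variable {G : Type} [Group G]

/-- The constant function `1`, as an element of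
`Ind_H^G ℤ = {f : G → ℤ | f (h g) = f g for all h ∈ H, g ∈ G}`. -/
def indOne (H : Subgroup G) :
    Representation.coindV H.subtype (Representation.trivial ℤ H ℤ) :=
  ⟨fun _ => 1, fun _ _ => by simp⟩

/-- The map `ε : ℤ → Ind_H^G ℤ`, `1 ↦ (g ↦ 1)`. -/
def indEps (H : Subgroup G) :
    ℤ →ₗ[ℤ] Representation.coindV H.subtype (Representation.trivial ℤ H ℤ) :=
  LinearMap.toSpanSingleton ℤ _ (indOne H)

theorem range_indEps_le (H : Subgroup G) (g : G) :
    LinearMap.range (indEps H) ≤ (LinearMap.range (indEps H)).comap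
      (Representation.coind H.subtype (Representation.trivial ℤ H ℤ) g) := by
  rintro _ ⟨n, rfl⟩
  refine ⟨n, ?_⟩
  ext x
  change n * 1 = n * 1
  rfl

/-- The `G`-module `J_{G/H}`, the cokernel of `ε : ℤ → Ind_H^G ℤ`. -/
def chevalleyJ (H : Subgroup G) : Rep.{0} ℤ G :=
  Rep.of ((Representation.coind H.subtype (Representation.trivial ℤ H ℤ)).quotient
    (LinearMap.range (indEps H)) (range_indEps_le H))

/-- The restriction map `H²(G, M) → H²(D, M)`. -/
def resH2 (M : Rep.{0} ℤ G) (D : Subgroup G) :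
    groupCohomology M 2 ⟶ groupCohomology (Rep.res D.subtype M) 2 :=
  groupCohomology.map D.subtype (CategoryTheory.CategoryStruct.id (Rep.res D.subtype M)) 2

/-- `Ш²_𝒟(G, M)`: the classes in `H²(G, M)` which restrict to `0` on every `D ∈ 𝒟`. -/
def sha2 (𝒟 : Set (Subgroup G)) (M : Rep.{0} ℤ G) : Submodule ℤ (groupCohomology M 2) :=
  ⨅ D ∈ 𝒟, LinearMap.ker (resH2 M D).hom

/-- The set of all cyclic subgroups of `G`. -/
def cyclicSubgroups (G : Type) [Group G] : Set (Subgroup G) := {C | IsCyclic C}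

/-- `Ш²_ω(G, M)`: the case where `𝒟` is the set of all cyclic subgroups. -/
def sha2Omega (M : Rep.{0} ℤ G) : Submodule ℤ (groupCohomology M 2) :=
  sha2 (cyclicSubgroups G) M

/-- A set of subgroups is admissible if it contains all cyclic subgroups and is stable under
conjugation. -/
def IsAdmissible (𝒟 : Set (Subgroup G)) : Prop :=
  cyclicSubgroups G ⊆ 𝒟 ∧
    ∀ (g : G), ∀ D ∈ 𝒟, D.map (MulAut.conj g).toMonoidHom ∈ 𝒟

/-- `D` contains a subgroup isomorphic to `(C_p)²`. -/
def ContainsCpSq (p : ℕ) (D : Subgroup G) : Prop :=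
  ∃ K : Subgroup G, K ≤ D ∧
    Nonempty (K ≃* Multiplicative (ZMod p) × Multiplicative (ZMod p))

end Cohomology

end

/-! Let `X = G/H`. The sequence `0 → J → J ⊗ ℚ → J ⊗ ℚ/ℤ → 0` identifies `H²(G, J)` with `H¹(G,
(ℚ/ℤ)^X / constants)`, so a class is a map `c : G → (ℚ/ℤ)^X` that is a 1-cocycle up to constants
(`Represents`). The monomial transformations whose function is `c g` up to a scalar form a central
extension `E` of `G` by `ℚ/ℤ`, and the class vanishes once `E` retracts onto its scalars by a map
killing the lifts that fix `(x₀, 0)` in `X × ℚ/ℤ`.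

Triviality on cyclic subgroups makes `c h` constant on the fixed points of `h`. Hence a lift of an
element with a fixed point commutes with every lift of an element commuting with it. A transitive
`p`-group of degree `p²` has an elementary abelian normal subgroup `N` of index `p` containing all
point stabilizers. The preimage of `N` in `E` is then abelian, and the only obstruction left is one
scalar: the commutator of lifts of a nontrivial central `z ∈ N` and of some `t ∉ N`
(`IsBlockKernel.trivialOn_top`).

This scalar vanishes if `t ^ p ≠ 1`, by taking `z = t ^ p`, and also if `H` has order greater than
`p`, by factoring `z` into elements with fixed points and comparing their canonical lifts. A nonzero
class therefore forces exponent `p` and `|H| ≤ p`, so `G` is `(C_p)²` or the Heisenberg group.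

Both groups carry coordinates `x, y, α` (`HeisChart`), and the class `α X - y X² / 2`, with `X` the
coordinate `x` of a point, has commutator scalar `-1/p`. If no member of `𝒟` contains `(C_p)²`, all
members are cyclic and this class generates a group of order `p`. If some member does, triviality on
it kills the commutator scalar. -/

noncomputable section

/-! ### Second cohomology of `J_{G/H}` by dimension shifting -/

section Shift

variable {G : Type} [Group G] {X : Type} [MulAction G X]

/-- Integral functions on a `G`-set with base point `x₀`, as elements of `Ind_H^G ℤ`. -/
def toCoind (x₀ : X) : (X → ℤ) →ₗ[ℤ]
    Representation.coindV (MulAction.stabilizer G x₀).subtype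
      (Representation.trivial ℤ (MulAction.stabilizer G x₀) ℤ) where
  toFun φ := ⟨fun k => φ (k⁻¹ • x₀), fun h k => by
    have : (h : G)⁻¹ • x₀ = x₀ := MulAction.mem_stabilizer_iff.1 (inv_mem h.2)
    simp [mul_smul, this]⟩
  map_add' _ _ := rfl
  map_smul' _ _ := rfl

theorem toCoind_surjective [MulAction.IsPretransitive G X] (x₀ : X) :
    Function.Surjective (toCoind (G := G) x₀) := by
  intro f
  choose k hk using fun y : X => MulAction.exists_smul_eq G y x₀
  refine ⟨fun y => f.1 (k y), ?_⟩
  ext g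
  change f.1 (k (g⁻¹ • x₀)) = f.1 g
  have hs : k (g⁻¹ • x₀) * g⁻¹ ∈ MulAction.stabilizer G x₀ := by
    rw [MulAction.mem_stabilizer_iff, mul_smul, hk]
  have := f.2 ⟨_, hs⟩ g
  simpa using this

/-- The projection from integral functions on `X` to `J_{G/H}`. -/
def mkJ (x₀ : X) : (X → ℤ) →ₗ[ℤ] chevalleyJ (MulAction.stabilizer G x₀) :=
  (Submodule.mkQ (LinearMap.range (indEps (MulAction.stabilizer G x₀)))).comp (toCoind x₀)

theorem mkJ_surjective [MulAction.IsPretransitive G X] (x₀ : X) :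
    Function.Surjective (mkJ (G := G) x₀) :=
  (Submodule.mkQ_surjective _).comp (toCoind_surjective x₀)

theorem mkJ_eq_zero_iff [MulAction.IsPretransitive G X] (x₀ : X) (φ : X → ℤ) :
    mkJ (G := G) x₀ φ = 0 ↔ ∃ n : ℤ, ∀ y, φ y = n := by
  have h : mkJ (G := G) x₀ φ = 0 ↔
      toCoind x₀ φ ∈ LinearMap.range (indEps (MulAction.stabilizer G x₀)) :=
    Submodule.Quotient.mk_eq_zero _
  rw [h]
  constructor
  · rintro ⟨n, hn⟩
    refine ⟨n, fun y => ?_⟩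
    obtain ⟨g, rfl⟩ := MulAction.exists_smul_eq G x₀ y
    have := congrFun (congrArg Subtype.val hn) g⁻¹
    change n * 1 = φ ((g⁻¹)⁻¹ • x₀) at this
    rw [inv_inv] at this
    omega
  · rintro ⟨n, hn⟩
    refine ⟨n, ?_⟩
    ext g
    change n * 1 = φ (g⁻¹ • x₀)
    rw [hn, mul_one]

theorem mkJ_eq_iff [MulAction.IsPretransitive G X] (x₀ : X) (φ ψ : X → ℤ) :
    mkJ (G := G) x₀ φ = mkJ x₀ ψ ↔ ∃ n : ℤ, ∀ y, φ y = ψ y + n := by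
  rw [← sub_eq_zero, ← map_sub, mkJ_eq_zero_iff]
  simp only [Pi.sub_apply, sub_eq_iff_eq_add']

theorem rho_mkJ (x₀ : X) (g : G) (φ : X → ℤ) :
    (chevalleyJ (MulAction.stabilizer G x₀)).ρ g (mkJ x₀ φ) = mkJ x₀ fun y => φ (g⁻¹ • y) := by
  change Submodule.Quotient.mk _ = Submodule.Quotient.mk _
  congr 1
  ext k
  change φ ((k * g)⁻¹ • x₀) = φ (g⁻¹ • k⁻¹ • x₀)
  rw [mul_inv_rev, mul_smul]

-- Identities in `J` become identities between integral functions up to an integer constant. Only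
-- the values of `B` on `D` enter the condition.
open groupCohomology in
theorem resH2_H2π_mkJ_eq_zero_iff [MulAction.IsPretransitive G X] (x₀ : X) (D : Subgroup G)
    (σ : cocycles₂ (chevalleyJ (MulAction.stabilizer G x₀))) (F : G → G → X → ℤ)
    (hF : ∀ g h, σ (g, h) = mkJ x₀ (F g h)) :
    (resH2 (chevalleyJ (MulAction.stabilizer G x₀)) D).hom (H2π _ σ) = 0 ↔
      ∃ B : G → X → ℤ, ∀ g ∈ D, ∀ h ∈ D, ∃ n : ℤ, ∀ y,
        F g h y = B h (g⁻¹ • y) - B (g * h) y + B g y + n := by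
  have h1 := H2π_comp_map_apply D.subtype (CategoryTheory.CategoryStruct.id
    (Rep.res D.subtype (chevalleyJ (MulAction.stabilizer G x₀)))) σ
  have h2 : (resH2 (chevalleyJ (MulAction.stabilizer G x₀)) D).hom (H2π _ σ) = 0 ↔
    ∃ β : D → chevalleyJ (MulAction.stabilizer G x₀), ∀ g h : D,
      σ ((g : G), (h : G)) =
        (chevalleyJ (MulAction.stabilizer G x₀)).ρ g (β h) - β (g * h) + β g := by
    unfold resH2
    erw [h1]
    rw [H2π_eq_zero_iff]
    constructor
    · rintro ⟨β, hβ⟩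
      exact ⟨β, fun g h => (congrFun hβ (g, h)).symm⟩
    · rintro ⟨β, hβ⟩
      exact ⟨β, funext fun gh => (hβ gh.1 gh.2).symm⟩
  rw [h2]
  have key : ∀ (B : G → X → ℤ) (g h : G),
      (σ (g, h) = (chevalleyJ (MulAction.stabilizer G x₀)).ρ g (mkJ x₀ (B h))
        - mkJ x₀ (B (g * h)) + mkJ x₀ (B g)) ↔ ∃ n : ℤ, ∀ y,
        F g h y = B h (g⁻¹ • y) - B (g * h) y + B g y + n := by
    intro B g h
    rw [hF, rho_mkJ, ← map_sub, ← map_add, mkJ_eq_iff]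
    rfl
  constructor
  · rintro ⟨β, hβ⟩
    choose B hB using fun g : D => mkJ_surjective (G := G) x₀ (β g)
    obtain ⟨B', hB'⟩ : ∃ B' : G → X → ℤ, ∀ g (hg : g ∈ D), mkJ x₀ (B' g) = β ⟨g, hg⟩ := by
      classical
      exact ⟨fun g => if hg : g ∈ D then B ⟨g, hg⟩ else 0,
        fun g hg => by simp only [hg, dif_pos, hB]⟩
    refine ⟨B', fun g hg h hh => (key B' g h).1 ?_⟩
    rw [hB' g hg, hB' h hh, hB' _ (mul_mem hg hh)]
    exact hβ ⟨g, hg⟩ ⟨h, hh⟩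
  · rintro ⟨B, hB⟩
    exact ⟨fun g => mkJ x₀ (B g), fun g h => (key B g h).2 (hB g g.2 h h.2)⟩

/-- A map `c : G → (ℚ/ℤ)^X` which is a `1`-cocycle modulo constant functions. -/
def IsProjCocycle (c : G → X → AddCircle (1 : ℚ)) : Prop :=
  ∀ g h, ∃ a, ∀ y, c (g * h) y = c g y + c h (g⁻¹ • y) + a

/-- The map `c` restricted to `D` is a coboundary modulo constant functions. -/
def TrivialOn (D : Subgroup G) (c : G → X → AddCircle (1 : ℚ)) : Prop :=
  ∃ u : X → AddCircle (1 : ℚ), ∀ g ∈ D, ∃ a, ∀ y, c g y = u y - u (g⁻¹ • y) + a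

/-- The class `v ∈ H²(G, J_{G/H})` is the image of `c` under the connecting map of
`0 → J → J ⊗ ℚ → J ⊗ ℚ/ℤ → 0`. -/
def Represents (x₀ : X) (v : groupCohomology (chevalleyJ (MulAction.stabilizer G x₀)) 2)
    (c : G → X → AddCircle (1 : ℚ)) : Prop :=
  ∃ (σ : groupCohomology.cocycles₂ (chevalleyJ (MulAction.stabilizer G x₀)))
    (F : G → G → X → ℤ) (q : G → X → ℚ),
    groupCohomology.H2π _ σ = v ∧ (∀ g h, σ (g, h) = mkJ x₀ (F g h)) ∧
    (∀ g y, c g y = (q g y : AddCircle (1 : ℚ))) ∧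
    ∀ g h, ∃ a : ℚ, ∀ y, (F g h y : ℚ) = q h (g⁻¹ • y) - q (g * h) y + q g y + a

theorem coe_int_addCircle (n : ℤ) : ((n : ℚ) : AddCircle (1 : ℚ)) = 0 :=
  (AddCircle.coe_eq_zero_iff _).2 ⟨n, by simp⟩

theorem Represents.isProjCocycle {x₀ : X}
    {v : groupCohomology (chevalleyJ (MulAction.stabilizer G x₀)) 2}
    {c : G → X → AddCircle (1 : ℚ)} (h : Represents x₀ v c) : IsProjCocycle c := by
  obtain ⟨σ, F, q, -, -, hc, hq⟩ := h
  intro g h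
  obtain ⟨a, ha⟩ := hq g h
  refine ⟨(a : AddCircle (1 : ℚ)), fun y => ?_⟩
  have h1 : q (g * h) y = q g y + q h (g⁻¹ • y) + a - (F g h y : ℚ) := by rw [ha]; ring
  rw [hc, hc, hc, h1, AddCircle.coe_sub, coe_int_addCircle, AddCircle.coe_add, AddCircle.coe_add,
    sub_zero]

theorem Represents.add {x₀ : X}
    {v w : groupCohomology (chevalleyJ (MulAction.stabilizer G x₀)) 2}
    {c d : G → X → AddCircle (1 : ℚ)} (h : Represents x₀ v c) (h' : Represents x₀ w d) :
    Represents x₀ (v + w) (c + d) := by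
  obtain ⟨σ, F, q, hv, hF, hc, hq⟩ := h
  obtain ⟨σ', F', q', hv', hF', hc', hq'⟩ := h'
  refine ⟨σ + σ', F + F', q + q', ?_, fun g h => ?_, fun g y => ?_, fun g h => ?_⟩
  · rw [map_add, hv, hv']
  · change σ (g, h) + σ' (g, h) = mkJ x₀ (F g h + F' g h)
    rw [hF, hF', map_add]
  · simp [hc, hc']
  · obtain ⟨a, ha⟩ := hq g h
    obtain ⟨a', ha'⟩ := hq' g h
    refine ⟨a + a', fun y => ?_⟩
    simp only [Pi.add_apply, Int.cast_add, ha, ha']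
    ring

theorem represents_zero (x₀ : X) : Represents (G := G) x₀ 0 0 :=
  ⟨0, 0, 0, map_zero _, fun g h => (map_zero (mkJ x₀)).symm, fun g y => by simp,
    fun g h => ⟨0, by simp⟩⟩

theorem Represents.nsmul {x₀ : X}
    {v : groupCohomology (chevalleyJ (MulAction.stabilizer G x₀)) 2}
    {c : G → X → AddCircle (1 : ℚ)} (h : Represents x₀ v c) (n : ℕ) :
    Represents x₀ (n • v) (n • c) := by
  induction n with
  | zero => simpa using represents_zero x₀
  | succ n ih => simpa only [succ_nsmul] using ih.add h

/-- Averaging kills `H²(G, J ⊗ ℚ)`: summing the cocycle identity over its last argument shows that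
`q g = |G|⁻¹ ∑ j, F g j` is a rational primitive, and `c` is its reduction modulo `ℤ`. -/
theorem exists_represents [Finite G] [MulAction.IsPretransitive G X] (x₀ : X)
    (v : groupCohomology (chevalleyJ (MulAction.stabilizer G x₀)) 2) :
    ∃ c, Represents x₀ v c := by
  induction v using groupCohomology.H2_induction_on with
  | h σ =>
  have := Fintype.ofFinite G
  choose F hF using fun g h => mkJ_surjective (G := G) x₀ (σ (g, h))
  let N : ℚ := Fintype.card G
  have hN : N ≠ 0 := by simp [N]
  let q : G → X → ℚ := fun g y => (∑ j, (F g j y : ℚ)) / N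
  refine ⟨fun g y => (q g y : AddCircle (1 : ℚ)), σ, F, q, rfl, fun g h => (hF g h).symm,
    fun _ _ => rfl, fun g h => ?_⟩
  have h1 : ∀ j, ∃ n : ℤ, ∀ y,
      F (g * h) j y + F g h y = F h j (g⁻¹ • y) + F g (h * j) y + n := by
    intro j
    have := (groupCohomology.mem_cocycles₂_iff σ.1).1 σ.2 g h j
    simp only [groupCohomology.cocycles₂.val_eq_coe, ← hF, rho_mkJ, ← map_add] at this
    exact (mkJ_eq_iff x₀ _ _).1 this
  choose n hn using h1
  refine ⟨(∑ j, (n j : ℚ)) / N, fun y => ?_⟩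
  have h2 : ∑ j, (F (g * h) j y : ℚ) + N * F g h y =
      ∑ j, (F h j (g⁻¹ • y) : ℚ) + ∑ j, (F g j y : ℚ) + ∑ j, (n j : ℚ) := by
    have h3 : ∑ j, (F g (h * j) y : ℚ) = ∑ j, (F g j y : ℚ) :=
      Fintype.sum_equiv (Equiv.mulLeft h) _ _ fun _ => rfl
    have h4 : N * F g h y = ∑ _j : G, (F g h y : ℚ) := by simp [N]
    rw [← h3, h4, ← Finset.sum_add_distrib, ← Finset.sum_add_distrib, ← Finset.sum_add_distrib]
    exact Finset.sum_congr rfl fun j _ => by exact_mod_cast hn j y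
  simp only [q]
  field_simp
  linarith

/-- Here `F` is the coboundary of a rational lift `q` of `c`, corrected by a lift `b` of the
constants. Its cocycle identity holds up to a rational number independent of the point, which is an
integer because `F` is integral. -/
theorem IsProjCocycle.exists_represents [MulAction.IsPretransitive G X] (x₀ : X)
    {c : G → X → AddCircle (1 : ℚ)} (hc : IsProjCocycle c) : ∃ v, Represents x₀ v c := by
  choose q hq using fun g y => QuotientAddGroup.mk_surjective (c g y)
  choose a ha using hc
  choose b hb using fun g h => QuotientAddGroup.mk_surjective (a g h)
  have h1 : ∀ g h y, ∃ n : ℤ,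
      (n : ℚ) = q h (g⁻¹ • y) - q (g * h) y + q g y + b g h := by
    intro g h y
    have h2 : ((q h (g⁻¹ • y) - q (g * h) y + q g y + b g h : ℚ) : AddCircle (1 : ℚ)) = 0 := by
      have := ha g h y
      rw [← hq, ← hq, ← hq, ← hb] at this
      rw [AddCircle.coe_add, AddCircle.coe_add, AddCircle.coe_sub]
      erw [this]
      abel
    obtain ⟨n, hn⟩ := (AddCircle.coe_eq_zero_iff _).1 h2
    exact ⟨n, by simpa using hn⟩
  choose F hF using h1
  have hσ : (fun gh : G × G => mkJ x₀ (F gh.1 gh.2)) ∈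
      groupCohomology.cocycles₂ (chevalleyJ (MulAction.stabilizer G x₀)) := by
    rw [groupCohomology.mem_cocycles₂_iff]
    intro g h j
    simp only [rho_mkJ, ← map_add]
    rw [mkJ_eq_iff]
    by_cases hX : Nonempty X
    · obtain ⟨y₀⟩ := hX
      have h3 : ∀ y, ((F (g * h) j y + F g h y - F h j (g⁻¹ • y) - F g (h * j) y : ℤ) : ℚ) =
          b (g * h) j + b g h - b h j - b g (h * j) := by
        intro y
        push_cast
        rw [hF, hF, hF, hF, mul_inv_rev, mul_smul, mul_assoc]
        ring
      refine ⟨F (g * h) j y₀ + F g h y₀ - F h j (g⁻¹ • y₀) - F g (h * j) y₀, fun y => ?_⟩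
      have := (h3 y).trans (h3 y₀).symm
      have := Int.cast_injective this
      simp only [Pi.add_apply]
      omega
    · exact ⟨0, fun y => (hX ⟨y⟩).elim⟩
  exact ⟨_, ⟨_, hσ⟩, F, q, rfl, fun _ _ => rfl, fun g y => (hq g y).symm,
    fun g h => ⟨b g h, hF g h⟩⟩

/-- Subtracting an integral primitive `B` from `q` leaves a rational cocycle on `D` modulo
constants, and averaging over `D` makes it a coboundary. Conversely, `q` minus a rational lift of a
coboundary expression for `c` is integral and is the required primitive. -/
theorem Represents.resH2_eq_zero_iff [Finite G] [MulAction.IsPretransitive G X] {x₀ : X}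
    {v : groupCohomology (chevalleyJ (MulAction.stabilizer G x₀)) 2}
    {c : G → X → AddCircle (1 : ℚ)} (h : Represents x₀ v c) (D : Subgroup G) :
    (resH2 (chevalleyJ (MulAction.stabilizer G x₀)) D).hom v = 0 ↔ TrivialOn D c := by
  obtain ⟨σ, F, q, rfl, hF, hc, hq⟩ := h
  rw [resH2_H2π_mkJ_eq_zero_iff x₀ D σ F hF]
  choose a ha using hq
  constructor
  · rintro ⟨B, hB⟩
    have := Fintype.ofFinite D
    let N : ℚ := Fintype.card D
    have hN : N ≠ 0 := by simp [N]
    let w : X → ℚ := fun y => (∑ j : D, (q j y - B j y)) / N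
    refine ⟨fun y => (w y : AddCircle (1 : ℚ)), fun g hg => ?_⟩
    have h1 : ∀ j : D, ∃ e : ℚ, ∀ y,
        q g y - B g y = (q (g * j) y - B (g * j) y) - (q j (g⁻¹ • y) - B j (g⁻¹ • y)) + e := by
      intro j
      obtain ⟨n, hn⟩ := hB g hg j j.2
      refine ⟨n - a g j, fun y => ?_⟩
      have h2 := ha g j y
      rw [hn] at h2
      push_cast at h2
      linarith
    choose e he using h1
    refine ⟨((∑ j, e j) / N : ℚ), fun y => ?_⟩
    have h3 : N * (q g y - B g y) = (∑ j : D, (q j y - B j y)) -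
        (∑ j : D, (q j (g⁻¹ • y) - B j (g⁻¹ • y))) + ∑ j, e j := by
      have h4 : ∑ j : D, (q (g * j) y - B (g * j) y) = ∑ j : D, (q j y - B j y) :=
        Fintype.sum_equiv (Equiv.mulLeft (⟨g, hg⟩ : D)) _ _ fun _ => rfl
      have h5 : N * (q g y - B g y) = ∑ _j : D, (q g y - B g y) := by simp [N, mul_sub]
      rw [← h4, h5, ← Finset.sum_sub_distrib, ← Finset.sum_add_distrib]
      exact Finset.sum_congr rfl fun j _ => he j y
    have h6 : q g y = w y - w (g⁻¹ • y) + (∑ j, e j) / N + (B g y : ℚ) := by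
      simp only [w]
      field_simp
      linarith
    rw [hc, h6, AddCircle.coe_add, coe_int_addCircle, add_zero, AddCircle.coe_add,
      AddCircle.coe_sub]
  · rintro ⟨u, hu⟩
    choose w hw using fun y => QuotientAddGroup.mk_surjective (u y)
    choose! e he using hu
    choose e' he' using fun g => QuotientAddGroup.mk_surjective (e g)
    have h1 : ∀ g ∈ D, ∀ y, ∃ n : ℤ, (n : ℚ) = q g y - (w y - w (g⁻¹ • y) + e' g) := by
      intro g hg y
      have h2 : ((q g y - (w y - w (g⁻¹ • y) + e' g) : ℚ) : AddCircle (1 : ℚ)) = 0 := by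
        rw [AddCircle.coe_sub, ← hc, AddCircle.coe_add, AddCircle.coe_sub, sub_eq_zero, he g hg,
          ← hw, ← hw, ← he']
      obtain ⟨n, hn⟩ := (AddCircle.coe_eq_zero_iff _).1 h2
      exact ⟨n, by simpa using hn⟩
    choose! B hB using h1
    refine ⟨B, fun g hg h hh => ?_⟩
    by_cases hX : Nonempty X
    · obtain ⟨y₀⟩ := hX
      have h3 : ∀ y, ((F g h y - B h (g⁻¹ • y) + B (g * h) y - B g y : ℤ) : ℚ) =
          a g h + e' g + e' h - e' (g * h) := by
        intro y
        push_cast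
        rw [ha, hB h hh, hB g hg, hB _ (mul_mem hg hh), mul_inv_rev, mul_smul]
        ring
      refine ⟨F g h y₀ - B h (g⁻¹ • y₀) + B (g * h) y₀ - B g y₀, fun y => ?_⟩
      have := Int.cast_injective ((h3 y).trans (h3 y₀).symm)
      omega
    · exact ⟨0, fun y => (hX ⟨y⟩).elim⟩

theorem Represents.eq_zero_iff [Finite G] [MulAction.IsPretransitive G X] {x₀ : X}
    {v : groupCohomology (chevalleyJ (MulAction.stabilizer G x₀)) 2}
    {c : G → X → AddCircle (1 : ℚ)} (h : Represents x₀ v c) :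
    v = 0 ↔ TrivialOn ⊤ c := by
  rw [← h.resH2_eq_zero_iff]
  constructor
  · rintro rfl
    exact map_zero _
  · intro hv
    obtain ⟨σ, F, q, rfl, hF, -, -⟩ := h
    rw [resH2_H2π_mkJ_eq_zero_iff x₀ ⊤ σ F hF] at hv
    obtain ⟨B, hB⟩ := hv
    rw [groupCohomology.H2π_eq_zero_iff]
    refine ⟨fun g => mkJ x₀ (B g), funext fun ⟨g, h⟩ => ?_⟩
    rw [hF, groupCohomology.d₁₂_hom_apply]
    simp only [rho_mkJ, ← map_sub, ← map_add]
    exact ((mkJ_eq_iff x₀ _ _).2 (hB g trivial h trivial)).symm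

theorem Represents.mem_sha2_iff [Finite G] [MulAction.IsPretransitive G X] {x₀ : X}
    {v : groupCohomology (chevalleyJ (MulAction.stabilizer G x₀)) 2}
    {c : G → X → AddCircle (1 : ℚ)} (h : Represents x₀ v c) (𝒟 : Set (Subgroup G)) :
    v ∈ sha2 𝒟 (chevalleyJ (MulAction.stabilizer G x₀)) ↔ ∀ D ∈ 𝒟, TrivialOn D c := by
  simp only [sha2, Submodule.mem_iInf, LinearMap.mem_ker, h.resH2_eq_zero_iff]

end Shift

/-! ### Retractions onto a central divisible subgroup -/

open scoped commutatorElement in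
-- On the abelian subgroup `N` the map `w ↦ [t, w]` is a homomorphism. Its image is normal, and
-- modulo it `t` commutes with `N`, so the quotient is abelian.
theorem commutator_le_of_abelian_normal {E : Type*} [Group E] (N : Subgroup E) [hN : N.Normal]
    (hcomm : ∀ a ∈ N, ∀ b ∈ N, Commute a b) (t : E)
    (ht : ∀ e : E, ∃ k : ℤ, ∃ n ∈ N, e = t ^ k * n) (e : E) (he : e ∈ commutator E) :
    ∃ w ∈ N, e = t * w * t⁻¹ * w⁻¹ := by
  have hconj : ∀ w ∈ N, t * w * t⁻¹ ∈ N := fun w hw => hN.conj_mem w hw t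
  let δ : N →* E := MonoidHom.mk' (fun w => t * w * t⁻¹ * (w : E)⁻¹) fun w w' => by
    have h1 : Commute (w : E)⁻¹ (t * w' * t⁻¹ * (w' : E)⁻¹) :=
      hcomm _ (inv_mem w.2) _ (mul_mem (hconj _ w'.2) (inv_mem w'.2))
    have h2 : t * (w * w') * t⁻¹ * ((w : E) * w')⁻¹ =
        t * w * t⁻¹ * ((t * w' * t⁻¹ * (w' : E)⁻¹) * (w : E)⁻¹) := by group
    rw [Subgroup.coe_mul, h2, ← h1.eq]
    group
  have hδ : ∀ w : N, δ w = t * w * t⁻¹ * (w : E)⁻¹ := fun _ => rfl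
  have hδN : ∀ x ∈ δ.range, x ∈ N := by
    rintro _ ⟨w, rfl⟩
    exact mul_mem (hconj _ w.2) (inv_mem w.2)
  have htn : t ∈ Subgroup.normalizer (δ.range : Set E) := by
    rw [Subgroup.mem_normalizer_iff]
    intro h
    constructor
    · rintro ⟨w, rfl⟩
      refine ⟨⟨_, hconj _ w.2⟩, ?_⟩
      rw [hδ, hδ]
      group
    · rintro ⟨w, hw⟩
      refine ⟨⟨t⁻¹ * w * t, by simpa using hN.conj_mem w w.2 t⁻¹⟩, ?_⟩
      have : h = t⁻¹ * (δ w) * t := by rw [hw]; group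
      rw [this, hδ, hδ]
      group
  have hnn : ∀ n ∈ N, n ∈ Subgroup.normalizer (δ.range : Set E) := by
    intro n hn
    have hfix : ∀ x ∈ N, n * x * n⁻¹ = x := fun x hx => by
      rw [(hcomm n hn x hx).eq, mul_inv_cancel_right]
    rw [Subgroup.mem_normalizer_iff]
    intro h
    constructor
    · intro hh
      change h ∈ δ.range at hh
      rwa [hfix h (hδN h hh)]
    · intro hh
      change n * h * n⁻¹ ∈ δ.range at hh
      have h1 : h ∈ N := by
        have := hN.conj_mem _ (hδN _ hh) n⁻¹
        simpa [mul_assoc] using this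
      rwa [hfix h h1] at hh
  have : δ.range.Normal := by
    rw [← Subgroup.normalizer_eq_top_iff, eq_top_iff]
    rintro e -
    obtain ⟨k, n, hn, rfl⟩ := ht e
    exact mul_mem (zpow_mem htn k) (hnn n hn)
  have hle : commutator E ≤ δ.range := by
    rw [commutator_def, Subgroup.commutator_le]
    intro g₁ _ g₂ _
    rw [← QuotientGroup.eq_one_iff]
    change QuotientGroup.mk' δ.range ⁅g₁, g₂⁆ = 1
    rw [map_commutatorElement, commutatorElement_eq_one_iff_commute]
    obtain ⟨k, n, hn, rfl⟩ := ht g₁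
    obtain ⟨l, m, hm, rfl⟩ := ht g₂
    have htN : ∀ n ∈ N, Commute (QuotientGroup.mk' δ.range t) (QuotientGroup.mk' δ.range n) := by
      intro n hn
      rw [← commutatorElement_eq_one_iff_commute, ← map_commutatorElement]
      exact (QuotientGroup.eq_one_iff _).2 ⟨⟨n, hn⟩, rfl⟩
    simp only [map_mul, map_zpow]
    exact (((Commute.refl _).zpow_zpow k l).mul_right ((htN m hm).zpow_left k)).mul_left
      (((htN n hn).zpow_left l).symm.mul_right ((hcomm n hn m hm).map _))
  obtain ⟨w, hw⟩ := hle he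
  exact ⟨w, w.2, hw.symm⟩

/-- As `ℚ/ℤ` is an injective abelian group, it suffices that the scalars inject into the
abelianization modulo the image of `S`. A scalar in the kernel lies in `[E, E] S`, and every element
of `[E, E]` is a single commutator with `t`. -/
theorem exists_retraction {E : Type*} [Group E] (ι : Multiplicative (AddCircle (1 : ℚ)) →* E)
    (N : Subgroup E) [N.Normal] (hcomm : ∀ a ∈ N, ∀ b ∈ N, Commute a b) (t : E)
    (ht : ∀ e : E, ∃ k : ℤ, ∃ n ∈ N, e = t ^ k * n) (S : Subgroup E)
    (h : ∀ w ∈ N, ∀ a, ∀ s ∈ S, t * w * t⁻¹ * w⁻¹ = ι a * s → a = 1) :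
    ∃ ψ : E →* Multiplicative (AddCircle (1 : ℚ)), (∀ a, ψ (ι a) = a) ∧ ∀ s ∈ S, ψ s = 1 := by
  let P := S.map (Abelianization.of (G := E))
  let π : E →* Abelianization E ⧸ P := (QuotientGroup.mk' P).comp Abelianization.of
  let f : AddCircle (1 : ℚ) →+ Additive (Abelianization E ⧸ P) :=
    MonoidHom.toAdditiveRight (π.comp ι)
  have hf : Function.Injective f.toIntLinearMap := by
    rw [← LinearMap.ker_eq_bot, LinearMap.ker_eq_bot']
    intro a ha
    have h1 : Abelianization.of (ι (Multiplicative.ofAdd a)) ∈ P :=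
      (QuotientGroup.eq_one_iff (N := P) _).1 ha
    obtain ⟨s, hs, hsa⟩ := h1
    have h2 : ι (Multiplicative.ofAdd a) * s⁻¹ ∈ commutator E := by
      rw [← Abelianization.ker_of, MonoidHom.mem_ker, map_mul, map_inv, hsa, mul_inv_cancel]
    obtain ⟨w, hw, hwe⟩ := commutator_le_of_abelian_normal N hcomm t ht _ h2
    exact h w hw (Multiplicative.ofAdd a) s⁻¹ (inv_mem hs) hwe.symm
  obtain ⟨χ, hχ⟩ := CharacterModule.dual_surjective_of_injective _ hf
    (AddMonoidHom.id (AddCircle (1 : ℚ)))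
  refine ⟨(AddMonoidHom.toMultiplicativeRight χ).comp π, fun a => ?_, fun s hs => ?_⟩
  · exact DFunLike.congr_fun hχ a.toAdd
  · have : π s = 1 := (QuotientGroup.eq_one_iff (N := P) _).2 ⟨s, hs, rfl⟩
    rw [MonoidHom.comp_apply, this, map_one]

/-! ### Monomial transformations -/

/-- Pairs of a function `X → ℚ/ℤ` and a group element acting on `X`. -/
@[ext]
structure Monomial (G X : Type) where
  /-- the function -/
  left : X → AddCircle (1 : ℚ)
  /-- the group element -/
  right : G

namespace Monomial

variable {G : Type} [Group G] {X : Type} [MulAction G X]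

instance : Mul (Monomial G X) :=
  ⟨fun a b => ⟨fun y => a.left y + b.left (a.right⁻¹ • y), a.right * b.right⟩⟩

instance : One (Monomial G X) := ⟨⟨fun _ => 0, 1⟩⟩

instance : Inv (Monomial G X) := ⟨fun a => ⟨fun y => -a.left (a.right • y), a.right⁻¹⟩⟩

@[simp] theorem mul_left_apply (a b : Monomial G X) (y : X) :
    (a * b).left y = a.left y + b.left (a.right⁻¹ • y) := rfl
@[simp] theorem mul_right (a b : Monomial G X) : (a * b).right = a.right * b.right := rfl
omit [MulAction G X] in
@[simp] theorem one_left_apply (y : X) : (1 : Monomial G X).left y = 0 := rfl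
omit [MulAction G X] in
@[simp] theorem one_right : (1 : Monomial G X).right = 1 := rfl
@[simp] theorem inv_left_apply (a : Monomial G X) (y : X) :
    a⁻¹.left y = -a.left (a.right • y) := rfl
@[simp] theorem inv_right (a : Monomial G X) : a⁻¹.right = a.right⁻¹ := rfl

instance : Group (Monomial G X) :=
  Group.ofLeftAxioms
    (fun a b c => Monomial.ext (funext fun y => by simp [mul_smul, add_assoc])
      (by simp [mul_assoc]))
    (fun a => Monomial.ext (funext fun y => by simp) (by simp))
    (fun a => Monomial.ext (funext fun y => by simp) (by simp))

/-- The projection of a monomial transformation to the underlying group. -/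
def rightHom : Monomial G X →* G := ⟨⟨right, rfl⟩, fun _ _ => rfl⟩

@[simp] theorem pow_right (a : Monomial G X) (n : ℕ) : (a ^ n).right = a.right ^ n :=
  map_pow rightHom a n
@[simp] theorem zpow_right (a : Monomial G X) (n : ℤ) : (a ^ n).right = a.right ^ n :=
  map_zpow rightHom a n

/-- The scalar monomial transformations. -/
def scalar : Multiplicative (AddCircle (1 : ℚ)) →* Monomial G X :=
  ⟨⟨fun a => ⟨fun _ => a.toAdd, 1⟩, rfl⟩,
    fun _ _ => Monomial.ext (funext fun _ => rfl) (one_mul 1).symm⟩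

@[simp] theorem scalar_left_apply (a : Multiplicative (AddCircle (1 : ℚ))) (y : X) :
    (scalar a : Monomial G X).left y = a.toAdd := rfl
@[simp] theorem scalar_right (a : Multiplicative (AddCircle (1 : ℚ))) :
    (scalar a : Monomial G X).right = 1 := rfl

theorem scalar_commute (a : Multiplicative (AddCircle (1 : ℚ))) (w : Monomial G X) :
    Commute (scalar a) w :=
  Monomial.ext (funext fun y => by simp [add_comm]) (by simp)

/-- The monomial transformations over `g` whose function is `c g` up to a constant. -/
def extGroup (c : G → X → AddCircle (1 : ℚ)) (hc : IsProjCocycle c) :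
    Subgroup (Monomial G X) where
  carrier := {w | ∃ a, ∀ y, w.left y = c w.right y + a}
  mul_mem' := by
    rintro w w' ⟨a, ha⟩ ⟨b, hb⟩
    obtain ⟨e, he⟩ := hc w.right w'.right
    refine ⟨a + b - e, fun y => ?_⟩
    rw [mul_left_apply, mul_right, ha, hb, he]
    abel
  one_mem' := by
    obtain ⟨a, ha⟩ := hc 1 1
    refine ⟨a, fun y => ?_⟩
    have := ha y
    rw [inv_one, one_smul, one_mul, add_assoc, left_eq_add] at this
    simpa using this.symm
  inv_mem' := by
    rintro w ⟨a, ha⟩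
    obtain ⟨e, he⟩ := hc w.right⁻¹ w.right
    obtain ⟨b, hb⟩ := hc 1 1
    refine ⟨e + b - a, fun y => ?_⟩
    have h1 := he y
    have h2 := hb y
    rw [inv_one, one_smul, one_mul, add_assoc, left_eq_add] at h2
    rw [inv_mul_cancel, inv_inv] at h1
    rw [inv_left_apply, inv_right, ha, eq_neg_of_add_eq_zero_right h2, h1]
    abel

/-- The monomial transformations fixing `(v, 0)` in `X × ℚ/ℤ`. -/
def fixator (v : X) : Subgroup (Monomial G X) where
  carrier := {w | w.right • v = v ∧ w.left v = 0}
  mul_mem' := by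
    rintro a b ⟨ha, ha'⟩ ⟨hb, hb'⟩
    refine ⟨by simp [mul_smul, hb, ha], ?_⟩
    simp [ha', inv_smul_eq_iff.2 ha.symm, hb']
  one_mem' := ⟨by simp, by simp⟩
  inv_mem' := by
    rintro a ⟨ha, ha'⟩
    exact ⟨by simp [inv_smul_eq_iff.2 ha.symm], by simp [ha, ha']⟩

theorem conj_mem_fixator {w : Monomial G X} {v : X} (hw : w ∈ fixator v) (t : Monomial G X) :
    t * w * t⁻¹ ∈ fixator (t.right • v) := by
  obtain ⟨hr, hl⟩ := hw
  refine ⟨by simp [mul_smul, hr], ?_⟩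
  simp [mul_smul, hl, inv_smul_eq_iff.2 hr.symm]

variable {c : G → X → AddCircle (1 : ℚ)} {hc : IsProjCocycle c}

theorem scalar_mem (a) : scalar a ∈ extGroup c hc := by
  obtain ⟨b, hb⟩ := (extGroup c hc).one_mem
  exact ⟨a.toAdd + b, fun (y : X) => by
    have := hb y
    simp only [one_left_apply, one_right] at this
    simp only [scalar_left_apply, scalar_right]
    rw [add_left_comm, ← this, add_zero]⟩

theorem lift_mem (g : G) : (⟨c g, g⟩ : Monomial G X) ∈ extGroup c hc :=
  ⟨0, fun _ => (add_zero _).symm⟩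

/-- Two lifts of one group element differ by a scalar, which a single point detects. In particular
an element fixing `v` has a unique lift in `fixator v`. -/
theorem ext_of_apply_eq {w w' : Monomial G X} (hw : w ∈ extGroup c hc) (hw' : w' ∈ extGroup c hc)
    (hr : w.right = w'.right) (v : X) (hv : w.left v = w'.left v) : w = w' := by
  obtain ⟨a, ha⟩ := hw
  obtain ⟨b, hb⟩ := hw'
  refine Monomial.ext (funext fun y => ?_) hr
  rw [ha, hb, hr] at hv
  rw [ha, hb, hr, add_left_cancel hv]

theorem eq_of_mem_fixator {w w' : Monomial G X} (hw : w ∈ extGroup c hc)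
    (hw' : w' ∈ extGroup c hc) (hr : w.right = w'.right) {v : X} (h : w ∈ fixator v)
    (h' : w' ∈ fixator v) : w = w' :=
  ext_of_apply_eq hw hw' hr v (h.2.trans h'.2.symm)

theorem exists_mem_fixator (hc : IsProjCocycle c) {h : G} {v : X} (hv : h • v = v) :
    ∃ w ∈ extGroup c hc, w ∈ fixator v ∧ w.right = h :=
  ⟨scalar (Multiplicative.ofAdd (-c h v)) * ⟨c h, h⟩, mul_mem (scalar_mem _) (lift_mem h),
    ⟨by simp [hv], by simp⟩, by simp⟩

theorem exists_eq_scalar_mul {w w' : Monomial G X} (hw : w ∈ extGroup c hc)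
    (hw' : w' ∈ extGroup c hc) (hr : w.right = w'.right) : ∃ a, w = scalar a * w' := by
  obtain ⟨a, ha⟩ := hw
  obtain ⟨b, hb⟩ := hw'
  refine ⟨Multiplicative.ofAdd (a - b), Monomial.ext (funext fun y => ?_)
    (by rw [mul_right, scalar_right, one_mul, hr])⟩
  rw [mul_left_apply, scalar_left_apply, scalar_right, inv_one, one_smul, ha, hb, hr, toAdd_ofAdd]
  abel

theorem commute_of_commute_of_right_eq {w w' z z' : Monomial G X} (hw : w ∈ extGroup c hc)
    (hw' : w' ∈ extGroup c hc) (hz : z ∈ extGroup c hc) (hz' : z' ∈ extGroup c hc)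
    (hr : w.right = w'.right) (hr' : z.right = z'.right) (h : Commute w z) : Commute w' z' := by
  obtain ⟨a, rfl⟩ := exists_eq_scalar_mul hw' hw hr.symm
  obtain ⟨b, rfl⟩ := exists_eq_scalar_mul hz' hz hr'.symm
  exact ((scalar_commute a _).mul_left
    ((scalar_commute b _).symm.mul_right h))

end Monomial

open Monomial

/-! ### Local triviality at cyclic subgroups and criteria for global triviality. -/

section Triviality

variable {G : Type} [Group G] {X : Type} [MulAction G X] {c : G → X → AddCircle (1 : ℚ)}

/-- The value of `c h` is the same at all fixed points of `h`. -/
def ConstOnFixed (c : G → X → AddCircle (1 : ℚ)) : Prop :=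
  ∀ (h : G) (v v' : X), h • v = v → h • v' = v' → c h v = c h v'

theorem TrivialOn.mono {D D' : Subgroup G} (hD : D ≤ D') (h : TrivialOn D' c) : TrivialOn D c :=
  h.imp fun _ hu g hg => hu g (hD hg)

/-- The term `u y - u (g⁻¹ • y)` vanishes at fixed points of `g`, which leaves only the constant. -/
theorem constOnFixed_of_trivialOn_zpowers (h : ∀ g : G, TrivialOn (Subgroup.zpowers g) c) :
    ConstOnFixed c := by
  intro g v v' hv hv'
  obtain ⟨u, hu⟩ := h g
  obtain ⟨a, ha⟩ := hu g (Subgroup.mem_zpowers g)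
  rw [ha, ha, inv_smul_eq_iff.2 hv.symm, inv_smul_eq_iff.2 hv'.symm, sub_self, sub_self]

theorem ConstOnFixed.left_eq (hS : ConstOnFixed c) {hc : IsProjCocycle c} {w : Monomial G X}
    (hw : w ∈ extGroup c hc) {v v' : X} (hv : w.right • v = v) (hv' : w.right • v' = v') :
    w.left v = w.left v' := by
  obtain ⟨a, ha⟩ := hw
  rw [ha, ha, hS _ v v' hv hv']

theorem ConstOnFixed.mem_fixator (hS : ConstOnFixed c) {hc : IsProjCocycle c} {w : Monomial G X}
    (hw : w ∈ extGroup c hc) {v v' : X} (h : w ∈ fixator v) (hv' : w.right • v' = v') :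
    w ∈ fixator v' :=
  ⟨hv', (hS.left_eq hw hv' h.1).trans h.2⟩

/-- At `v` the two products differ by the values of `w` at `v` and at `w'.right⁻¹ • v`. The latter
is again a fixed point of `w.right` because the group elements commute. -/
theorem ConstOnFixed.commute (hS : ConstOnFixed c) {hc : IsProjCocycle c} {w w' : Monomial G X}
    (hw : w ∈ extGroup c hc) (hw' : w' ∈ extGroup c hc) {v : X} (hv : w.right • v = v)
    (h : Commute w.right w'.right) : Commute w w' := by
  refine ext_of_apply_eq (mul_mem hw hw') (mul_mem hw' hw) h v ?_
  have h1 : w.right • (w'.right⁻¹ • v) = w'.right⁻¹ • v := by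
    rw [← mul_smul, h.inv_right.eq, mul_smul, hv]
  have h2 : w.right⁻¹ • v = v := inv_smul_eq_iff.2 (Eq.symm hv)
  simp only [mul_left_apply]
  rw [hS.left_eq hw h1 hv, h2, add_comm]

theorem TrivialOn.commute_lift {D : Subgroup G} (h : TrivialOn D c) {g g' : G} (hg : g ∈ D)
    (hg' : g' ∈ D) (hgg : Commute g g') :
    Commute (⟨c g, g⟩ : Monomial G X) ⟨c g', g'⟩ := by
  obtain ⟨u, hu⟩ := h
  obtain ⟨a, ha⟩ := hu g hg
  obtain ⟨b, hb⟩ := hu g' hg'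
  refine Monomial.ext (funext fun y => ?_) hgg
  simp only [mul_left_apply, ha, hb]
  have : g'⁻¹ • g⁻¹ • y = g⁻¹ • g'⁻¹ • y := by
    rw [← mul_smul, ← mul_smul, ← mul_inv_rev, ← mul_inv_rev, hgg.eq]
  rw [this]
  abel

/-- Subtracting the value of `ψ` on the lift turns `c` into a genuine cocycle `d` whose restriction
to the stabilizer vanishes at `x₀`. As in Shapiro's lemma, `d` is the coboundary of `y ↦ d g y` for
any `g` with `g • x₀ = y`. -/
theorem trivialOn_top_of_retraction [MulAction.IsPretransitive G X] (x₀ : X) (hc : IsProjCocycle c)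
    (ψ : extGroup c hc →* Multiplicative (AddCircle (1 : ℚ)))
    (hψ : ∀ a, ψ ⟨scalar a, scalar_mem a⟩ = a)
    (hψ0 : ∀ w : extGroup c hc, w.1.right • x₀ = x₀ → w.1.left x₀ = 0 → ψ w = 1) :
    TrivialOn ⊤ c := by
  let χ : G → AddCircle (1 : ℚ) := fun g => (ψ ⟨⟨c g, g⟩, lift_mem g⟩).toAdd
  let d : G → X → AddCircle (1 : ℚ) := fun g y => c g y - χ g
  have hd : ∀ w : extGroup c hc, ∀ y, w.1.left y = d w.1.right y + (ψ w).toAdd := by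
    intro w y
    obtain ⟨a, ha⟩ := exists_eq_scalar_mul w.2 (lift_mem (hc := hc) w.1.right) rfl
    have h1 : w = ⟨scalar a, scalar_mem a⟩ * ⟨⟨c w.1.right, w.1.right⟩, lift_mem _⟩ :=
      Subtype.ext ha
    have h2 := congrArg ψ h1
    rw [map_mul, hψ] at h2
    have h3 := congrArg (fun z : Monomial G X => z.left y) ha
    simp only [mul_left_apply, scalar_left_apply, scalar_right, inv_one, one_smul] at h3
    rw [h3, h2, toAdd_mul]
    simp only [d, χ]
    abel
  have hmul : ∀ g h y, d (g * h) y = d g y + d h (g⁻¹ • y) := by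
    intro g h y
    have := hd (⟨⟨c g, g⟩, lift_mem g⟩ * ⟨⟨c h, h⟩, lift_mem h⟩) y
    rw [map_mul, toAdd_mul] at this
    simp only [Subgroup.coe_mul, mul_left_apply, Monomial.mul_right] at this
    rw [← sub_eq_iff_eq_add] at this
    rw [← this]
    simp only [d, χ]
    abel
  have hstab : ∀ h : G, h • x₀ = x₀ → d h x₀ = 0 := by
    intro h hh
    let w : extGroup c hc :=
      ⟨scalar (Multiplicative.ofAdd (-c h x₀)) * ⟨c h, h⟩, mul_mem (scalar_mem _) (lift_mem h)⟩
    have hw0 : w.1.left x₀ = 0 := by simp [w]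
    have hwr : w.1.right = h := by simp [w]
    have h1 := hψ0 w (by rw [hwr, hh]) hw0
    have h2 := hd w x₀
    rw [h1, hwr, hw0] at h2
    simpa using h2.symm
  have hval : ∀ g h : G, g • x₀ = h • x₀ → d g (g • x₀) = d h (h • x₀) := by
    intro g h hgh
    have h1 : h = g * (g⁻¹ * h) := by group
    have h2 : (g⁻¹ * h) • x₀ = x₀ := by rw [mul_smul, ← hgh, inv_smul_smul]
    have h3 : h • x₀ = g • x₀ := hgh.symm
    rw [h3]
    conv_rhs => rw [h1, hmul, inv_smul_smul, hstab _ h2, add_zero]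
  choose k hk using MulAction.exists_smul_eq G x₀
  refine ⟨fun y => d (k y) y, fun g _ => ⟨χ g, fun y => ?_⟩⟩
  have h1 : d (k y) y = d (g * k (g⁻¹ • y)) y := by
    have := hval (k y) (g * k (g⁻¹ • y)) (by rw [mul_smul, hk, hk, smul_inv_smul])
    rwa [mul_smul, hk, hk, smul_inv_smul] at this
  change c g y = d (k y) y - d (k (g⁻¹ • y)) (g⁻¹ • y) + χ g
  rw [h1, hmul, add_sub_cancel_right]
  simp only [d]
  abel

/-- A class which is locally trivial at cyclic subgroups is trivial once the lifts of
a central element and of a generator modulo an abelian normal subgroup commute. -/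
theorem trivialOn_top_of_commute [MulAction.IsPretransitive G X] (x₀ : X) (hc : IsProjCocycle c)
    (hS : ConstOnFixed c) (N : Subgroup G) [hN : N.Normal]
    (hcomm : ∀ a ∈ N, ∀ b ∈ N, Commute a b) (hstab : MulAction.stabilizer G x₀ ≤ N)
    (z t : G) (hz : z ∈ N)
    (hzN : ∀ n ∈ N, ∃ k : ℤ, z ^ k * n ∈ MulAction.stabilizer G x₀)
    (ht : ∀ g : G, ∃ k : ℤ, ∃ n ∈ N, g = t ^ k * n)
    (hzt : Commute (⟨c z, z⟩ : Monomial G X) ⟨c t, t⟩) : TrivialOn ⊤ c := by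
  let r : extGroup c hc →* G := rightHom.comp (extGroup c hc).subtype
  let zl : extGroup c hc := ⟨⟨c z, z⟩, lift_mem z⟩
  let tl : extGroup c hc := ⟨⟨c t, t⟩, lift_mem t⟩
  have hztl : Commute zl tl := Subtype.ext hzt
  let ι : Multiplicative (AddCircle (1 : ℚ)) →* extGroup c hc :=
    scalar.codRestrict (extGroup c hc) scalar_mem
  let S : Subgroup (extGroup c hc) := (fixator x₀).subgroupOf (extGroup c hc)
  have hfix : ∀ w w' : extGroup c hc, r w • x₀ = x₀ → r w' ∈ N → Commute w w' := by
    intro w w' hw hw'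
    exact Subtype.ext (hS.commute w.2 w'.2 hw (hcomm _ (hstab hw) _ hw'))
  -- Up to a power of the lift of `z`, an element over `N` fixes `x₀`, and such elements commute
  -- with everything over `N`.
  have hNt : ∀ a ∈ N.comap r, ∀ b ∈ N.comap r, Commute a b := by
    intro a ha b hb
    obtain ⟨k, hk⟩ := hzN _ ha
    obtain ⟨l, hl⟩ := hzN _ hb
    have hzl : r zl ∈ N := hz
    have e1 : a = zl ^ (-k) * (zl ^ k * a) := by group
    have e2 : b = zl ^ (-l) * (zl ^ l * b) := by group
    have hk' : r (zl ^ k * a) • x₀ = x₀ := by rw [map_mul, map_zpow]; exact hk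
    have hl' : r (zl ^ l * b) • x₀ = x₀ := by rw [map_mul, map_zpow]; exact hl
    have c1 := hfix _ (zl ^ l * b) hk' (hstab hl')
    have c2 := hfix _ zl hk' hzl
    have c3 := hfix _ zl hl' hzl
    rw [e1, e2]
    exact (((Commute.refl zl).zpow_zpow _ _).mul_right (c3.symm.zpow_left _)).mul_left
      ((c2.zpow_right _).mul_right c1)
  have htt : ∀ e : extGroup c hc, ∃ k : ℤ, ∃ n ∈ N.comap r, e = tl ^ k * n := by
    intro e
    obtain ⟨k, n, hn, he⟩ := ht (r e)
    refine ⟨k, tl ^ (-k) * e, ?_, by group⟩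
    rw [Subgroup.mem_comap, map_mul, map_zpow, he]
    change t ^ (-k) * (t ^ k * n) ∈ N
    simpa using hn
  obtain ⟨ψ, hψ, hψ0⟩ := exists_retraction ι (N.comap r) hNt tl htt S (by
    rintro w hw a s ⟨hs, hs0⟩ hws
    change s.1.right • x₀ = x₀ at hs
    change s.1.left x₀ = 0 at hs0
    obtain ⟨k, hk⟩ := hzN _ hw
    -- This replacement leaves the commutator with `tl` unchanged, since `zl` commutes with `tl`,
    -- and arranges that `w'` fixes `x₀`.
    let w' : extGroup c hc := zl ^ k * w
    have h1 : tl * w' * tl⁻¹ * w'⁻¹ = tl * w * tl⁻¹ * w⁻¹ := by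
      have := (hztl.zpow_left k).eq
      calc tl * w' * tl⁻¹ * w'⁻¹ = (tl * zl ^ k) * w * tl⁻¹ * w⁻¹ * (zl ^ k)⁻¹ := by
            simp only [w']; group
        _ = zl ^ k * (tl * w * tl⁻¹ * w⁻¹) * (zl ^ k)⁻¹ := by rw [← this]; group
        _ = _ := by
          rw [mul_inv_eq_iff_eq_mul]
          refine (hNt _ ?_ _ ?_)
          · exact zpow_mem (show zl ∈ N.comap r from hz) k
          · exact mul_mem ((N.normal_comap r).conj_mem _ hw _) (inv_mem hw)
    have hw'0 : w'.1.right • x₀ = x₀ := by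
      have : r (zl ^ k * w) • x₀ = x₀ := by rw [map_mul, map_zpow]; exact hk
      exact this
    have hr : t * w'.1.right * t⁻¹ * w'.1.right⁻¹ = s.1.right := by
      have := congrArg r (h1.trans hws)
      simp only [map_mul, map_inv] at this
      refine this.trans ?_
      change 1 * s.1.right = _
      rw [one_mul]
    have hc1 : t * w'.1.right * t⁻¹ = s.1.right * w'.1.right := by rw [← hr]; group
    have hfix1 : w'.1.right • t⁻¹ • x₀ = t⁻¹ • x₀ := by
      have h2 : (t * w'.1.right * t⁻¹) • x₀ = x₀ := by rw [hc1, mul_smul, hw'0, hs]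
      rw [eq_inv_smul_iff, ← mul_smul, ← mul_smul]
      simpa [mul_assoc] using h2
    -- At `x₀` the left side is the value of `w'` at `t⁻¹ • x₀`, the right side is `a` plus its
    -- value at `x₀`. Both are fixed points of `w'`, so `a` is trivial.
    have h3 : tl * w' * tl⁻¹ = ι a * s * w' := by rw [← hws, ← h1]; group
    have h4 := congrArg (fun e : extGroup c hc => e.1.left x₀) h3
    have h5 : (ι a).1 = scalar a := rfl
    have h6 : tl.1 = ⟨c t, t⟩ := rfl
    simp only [Subgroup.coe_mul, mul_left_apply, h5, h6, Subgroup.coe_inv, inv_left_apply,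
      scalar_left_apply, Monomial.mul_right, scalar_right, hs0, one_mul, inv_one, one_smul,
      mul_inv_rev, mul_smul, inv_smul_eq_iff.2 (Eq.symm hs), inv_smul_eq_iff.2 hfix1.symm,
      smul_inv_smul] at h4
    rw [hS.left_eq w'.2 hfix1 hw'0] at h4
    simpa using h4.symm)
  exact trivialOn_top_of_retraction x₀ hc ψ hψ fun w h1 h2 => hψ0 w ⟨h1, h2⟩

end Triviality

/-! ### Transitive `p`-groups of degree `p²` -/

theorem normal_of_index_eq_prime {p : ℕ} [hp : Fact p.Prime] {G : Type*} [Group G] [Finite G]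
    (hG : IsPGroup p G) (N : Subgroup G) (h : N.index = p) : N.Normal := by
  obtain ⟨k, hk⟩ := IsPGroup.iff_card.1 hG
  refine Subgroup.normal_of_index_eq_minFac_card ?_
  have hk0 : k ≠ 0 := by
    rintro rfl
    have := N.index_dvd_card
    rw [hk, h, pow_zero, Nat.dvd_one] at this
    exact hp.out.one_lt.ne' this
  rw [h, hk, hp.out.pow_minFac hk0]

theorem exists_zpow_mul_mem_of_index_eq_prime {p : ℕ} [hp : Fact p.Prime] {G : Type*} [Group G]
    (N : Subgroup G) [N.Normal] (h : N.index = p) {t : G} (ht : t ∉ N) (g : G) :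
    ∃ k : ℤ, t ^ k * g ∈ N := by
  have hcard : Nat.card (G ⧸ N) = p := h
  obtain ⟨k, hk⟩ := Subgroup.mem_zpowers_iff.1 (mem_zpowers_of_prime_card hcard
    (g := (t : G ⧸ N)) (g' := (g : G ⧸ N)) (by rwa [Ne, QuotientGroup.eq_one_iff]))
  refine ⟨-k, ?_⟩
  rw [← QuotientGroup.eq_one_iff, QuotientGroup.mk_mul, QuotientGroup.mk_zpow, ← hk]
  group

theorem pow_mem_of_index_eq {p : ℕ} {G : Type*} [Group G]
    (N : Subgroup G) [N.Normal] (h : N.index = p) (g : G) : g ^ p ∈ N :=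
  h ▸ N.pow_index_mem g

theorem commutator_mem_of_index_eq_prime {p : ℕ} [hp : Fact p.Prime] {G : Type*} [Group G]
    (N : Subgroup G) [N.Normal] (h : N.index = p) (a b : G) : a * b * a⁻¹ * b⁻¹ ∈ N := by
  have hcard : Nat.card (G ⧸ N) = p := h
  have := isCyclic_of_prime_card hcard
  rw [← QuotientGroup.eq_one_iff]
  have h1 : (a : G ⧸ N) * b = b * a := mul_comm' (a : G ⧸ N) (b : G ⧸ N)
  simp only [QuotientGroup.mk_mul, QuotientGroup.mk_inv, h1]
  group

section Transitive

variable {p : ℕ} [hp : Fact p.Prime] {G : Type} [Group G] [Finite G] {X : Type} [MulAction G X]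

omit [Finite G] in
theorem eq_bot_of_normal_le_stabilizer [FaithfulSMul G X] [MulAction.IsPretransitive G X]
    (K : Subgroup G) [hK : K.Normal] (x₀ : X) (h : K ≤ MulAction.stabilizer G x₀) : K = ⊥ := by
  rw [eq_bot_iff]
  intro k hk
  rw [Subgroup.mem_bot]
  refine FaithfulSMul.eq_of_smul_eq_smul (α := X) fun y => ?_
  obtain ⟨g, rfl⟩ := MulAction.exists_smul_eq G x₀ y
  have := h (hK.conj_mem k hk g⁻¹)
  rw [MulAction.mem_stabilizer_iff, inv_inv, mul_smul, mul_smul, inv_smul_eq_iff] at this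
  rw [this, one_smul]

omit [Finite G] in
theorem eq_one_of_central_of_smul_eq [FaithfulSMul G X] [MulAction.IsPretransitive G X]
    {z : G} (hz : ∀ g, Commute z g) {x : X} (h : z • x = x) : z = 1 := by
  refine FaithfulSMul.eq_of_smul_eq_smul (α := X) fun y => ?_
  obtain ⟨g, rfl⟩ := MulAction.exists_smul_eq G x y
  rw [← mul_smul, (hz g).eq, mul_smul, h, one_smul]

omit hp [Finite G] in
theorem card_eq_mul_card_stabilizer [MulAction.IsPretransitive G X] (hX : Nat.card X = p ^ 2)
    (x : X) : Nat.card G = p ^ 2 * Nat.card (MulAction.stabilizer G x) := by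
  rw [← (MulAction.stabilizer G x).card_mul_index, MulAction.index_stabilizer_of_transitive, hX,
    mul_comm]

/-- `N` is a normal subgroup of index `p` containing all point stabilizers. -/
structure IsBlockKernel (p : ℕ) (X : Type) {G : Type} [Group G] [MulAction G X]
    (N : Subgroup G) : Prop where
  normal : N.Normal
  index_eq : N.index = p
  stabilizer_le : ∀ x : X, MulAction.stabilizer G x ≤ N
  relIndex_eq : ∀ x : X, (MulAction.stabilizer G x).relIndex N = p

omit [Finite G] in
theorem isBlockKernel_of_stabilizer_le [MulAction.IsPretransitive G X] (hX : Nat.card X = p ^ 2)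
    (N : Subgroup G) (hn : N.Normal) (hidx : N.index = p) (x₀ : X)
    (hle : MulAction.stabilizer G x₀ ≤ N) : IsBlockKernel p X N := by
  have hst : ∀ x : X, MulAction.stabilizer G x ≤ N := by
    intro x
    obtain ⟨g, rfl⟩ := MulAction.exists_smul_eq G x₀ x
    intro h hh
    have h1 : g⁻¹ * h * g ∈ MulAction.stabilizer G x₀ := by
      rw [MulAction.mem_stabilizer_iff, mul_smul, mul_smul, inv_smul_eq_iff]
      exact hh
    have := hn.conj_mem _ (hle h1) g
    simpa [mul_assoc] using this
  refine ⟨hn, hidx, hst, fun x => ?_⟩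
  have h1 := Subgroup.relIndex_mul_index (hst x)
  rw [hidx, MulAction.index_stabilizer_of_transitive, hX, pow_two] at h1
  exact Nat.eq_of_mul_eq_mul_right hp.out.pos h1

/-- In a `p`-group a proper subgroup has index `p` in some larger subgroup. Applied to a stabilizer,
of index `p²`, this gives a subgroup of index `p`, which is normal. -/
theorem exists_isBlockKernel [MulAction.IsPretransitive G X] (hX : Nat.card X = p ^ 2)
    (hG : IsPGroup p G) (x₀ : X) : ∃ N : Subgroup G, IsBlockKernel p X N := by
  have hcard := card_eq_mul_card_stabilizer (G := G) hX x₀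
  obtain ⟨m, hm⟩ := IsPGroup.iff_card.1 (hG.to_subgroup (MulAction.stabilizer G x₀))
  obtain ⟨N, hN, hle⟩ := Sylow.exists_subgroup_card_pow_succ (p := p) (n := m)
    (H := MulAction.stabilizer G x₀) ⟨p, by rw [hcard, hm]; ring⟩ hm
  have hidx : N.index = p := by
    have h1 := N.card_mul_index
    rw [hcard, hm, hN] at h1
    have : p ^ (m + 1) * N.index = p ^ (m + 1) * p := by rw [h1]; ring
    exact Nat.eq_of_mul_eq_mul_left (pow_pos hp.out.pos _) this
  exact ⟨N, isBlockKernel_of_stabilizer_le hX N (normal_of_index_eq_prime hG N hidx) hidx x₀ hle⟩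

namespace IsBlockKernel

variable {N : Subgroup G}

omit [Finite G] in
theorem exists_zpow_mul_mem (hN : IsBlockKernel p X N) {t : G} (ht : t ∉ N) (g : G) :
    ∃ k : ℤ, ∃ n ∈ N, g = t ^ k * n := by
  have := hN.normal
  obtain ⟨k, hk⟩ := exists_zpow_mul_mem_of_index_eq_prime N hN.index_eq ht g
  exact ⟨-k, _, hk, by group⟩

theorem stabilizer_subgroupOf_normal (hN : IsBlockKernel p X N) (hG : IsPGroup p G) (x : X) :
    ((MulAction.stabilizer G x).subgroupOf N).Normal :=
  normal_of_index_eq_prime (hG.to_subgroup N) _ (hN.relIndex_eq x)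

theorem exists_zpow_mul_mem_stabilizer (hN : IsBlockKernel p X N) (hG : IsPGroup p G) (x : X)
    {d n : G} (hd : d ∈ N) (hdx : d ∉ MulAction.stabilizer G x) (hn : n ∈ N) :
    ∃ k : ℤ, d ^ k * n ∈ MulAction.stabilizer G x := by
  have := hN.stabilizer_subgroupOf_normal hG x
  obtain ⟨k, hk⟩ := exists_zpow_mul_mem_of_index_eq_prime
    ((MulAction.stabilizer G x).subgroupOf N) (hN.relIndex_eq x) (t := ⟨d, hd⟩)
    (by rwa [Subgroup.mem_subgroupOf]) ⟨n, hn⟩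
  exact ⟨k, by simpa [Subgroup.mem_subgroupOf] using hk⟩

variable [FaithfulSMul G X]

/-- Every point stabilizer is normal in `N` with quotient of order `p`, so commutators fix all
points, and the action is faithful. The same argument applies to `p`-th powers. -/
theorem commute (hN : IsBlockKernel p X N) (hG : IsPGroup p G) {a b : G} (ha : a ∈ N)
    (hb : b ∈ N) : Commute a b := by
  have h : a * b * a⁻¹ * b⁻¹ = 1 := by
    refine FaithfulSMul.eq_of_smul_eq_smul (α := X) fun y => ?_
    have := hN.stabilizer_subgroupOf_normal hG y
    have h1 := commutator_mem_of_index_eq_prime ((MulAction.stabilizer G y).subgroupOf N)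
      (hN.relIndex_eq y) ⟨a, ha⟩ ⟨b, hb⟩
    rw [one_smul]
    exact h1
  rw [mul_inv_eq_one, mul_inv_eq_iff_eq_mul] at h
  exact h

theorem pow_eq_one (hN : IsBlockKernel p X N) (hG : IsPGroup p G) {a : G} (ha : a ∈ N) :
    a ^ p = 1 := by
  refine FaithfulSMul.eq_of_smul_eq_smul (α := X) fun y => ?_
  have := hN.stabilizer_subgroupOf_normal hG y
  have h1 := pow_mem_of_index_eq ((MulAction.stabilizer G y).subgroupOf N)
    (hN.relIndex_eq y) ⟨a, ha⟩
  rw [one_smul]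
  exact h1

omit hp [Finite G] [FaithfulSMul G X] in
theorem card_eq (hN : IsBlockKernel p X N) (x : X) :
    Nat.card N = p * Nat.card (MulAction.stabilizer G x) := by
  have h1 := ((MulAction.stabilizer G x).subgroupOf N).card_mul_index
  rw [Nat.card_congr (Subgroup.subgroupOfEquivOfLe (hN.stabilizer_le x)).toEquiv] at h1
  rw [← h1, mul_comm]
  congr 1
  exact hN.relIndex_eq x

-- The conjugation action of the `p`-group `G` on `N`, whose order is divisible by `p`, fixes `1`
-- and hence another element.
omit [FaithfulSMul G X] in
theorem exists_central (hN : IsBlockKernel p X N) (hG : IsPGroup p G) (x : X) :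
    ∃ z ∈ N, z ≠ 1 ∧ ∀ g, Commute z g := by
  have := hN.normal
  have hdvd : p ∣ Nat.card N := ⟨_, hN.card_eq x⟩
  have := Fintype.ofFinite N
  have hG' := hG.of_equiv ConjAct.toConjAct
  obtain ⟨b, hb, hb1⟩ := hG'.exists_fixed_point_of_prime_dvd_card_of_fixed_point
    N hdvd (a := 1) (fun g => by simp)
  refine ⟨b, b.2, fun h => hb1 (Subtype.ext h.symm), fun g => ?_⟩
  have h1 := congrArg Subtype.val (hb (ConjAct.toConjAct g))
  rw [ConjAct.Subgroup.val_conj_smul, ConjAct.smul_def, ConjAct.ofConjAct_toConjAct,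
    mul_inv_eq_iff_eq_mul] at h1
  exact h1.symm

variable [MulAction.IsPretransitive G X] {c : G → X → AddCircle (1 : ℚ)}

/-- A class which is locally trivial at cyclic subgroups is trivial once the lifts of a
nontrivial central `z ∈ N` and of some `t ∉ N` commute. -/
theorem trivialOn_top (hN : IsBlockKernel p X N) (hG : IsPGroup p G) (x₀ : X)
    (hc : IsProjCocycle c) (hS : ConstOnFixed c) {z t : G} (hz : z ∈ N) (hz1 : z ≠ 1)
    (hzc : ∀ g, Commute z g) (ht : t ∉ N)
    (hzt : Commute (⟨c z, z⟩ : Monomial G X) ⟨c t, t⟩) : TrivialOn ⊤ c := by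
  have := hN.normal
  refine trivialOn_top_of_commute x₀ hc hS N (fun a ha b hb => hN.commute hG ha hb)
    (hN.stabilizer_le x₀) z t hz (fun n hn => ?_) (hN.exists_zpow_mul_mem ht) hzt
  exact hN.exists_zpow_mul_mem_stabilizer hG x₀ hz
    (fun h => hz1 (eq_one_of_central_of_smul_eq hzc h)) hn

/-- The element `t ^ p` lies in `N` and commutes with `t`, so it is central, and it has a lift that
is a power of the lift of `t`. -/
theorem trivialOn_top_of_pow_ne_one (hN : IsBlockKernel p X N) (hG : IsPGroup p G) (x₀ : X)
    (hc : IsProjCocycle c) (hS : ConstOnFixed c) {t : G} (ht : t ∉ N) (htp : t ^ p ≠ 1) :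
    TrivialOn ⊤ c := by
  have := hN.normal
  have hz : t ^ p ∈ N := pow_mem_of_index_eq N hN.index_eq t
  refine hN.trivialOn_top hG x₀ hc hS hz htp (fun g => ?_) ht ?_
  · obtain ⟨k, n, hn, rfl⟩ := hN.exists_zpow_mul_mem ht g
    exact (((Commute.refl t).pow_left p).zpow_right k).mul_right (hN.commute hG hz hn)
  · exact Monomial.commute_of_commute_of_right_eq
      (pow_mem (Monomial.lift_mem (hc := hc) t) p) (Monomial.lift_mem _) (Monomial.lift_mem t)
      (Monomial.lift_mem _) (Monomial.pow_right _ _) rfl ((Commute.refl _).pow_left p)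

end IsBlockKernel

end Transitive

/-! ### Commuting lifts obtained from products of elements with fixed points. -/

section Large

variable {p : ℕ} [hp : Fact p.Prime] {G : Type} [Group G] [Finite G] {X : Type} [MulAction G X]
  {N : Subgroup G} {c : G → X → AddCircle (1 : ℚ)}

theorem IsBlockKernel.normal_of_conj_mem [FaithfulSMul G X] (hN : IsBlockKernel p X N)
    (hG : IsPGroup p G) {K : Subgroup G} (hK : K ≤ N) {t : G} (ht : t ∉ N)
    (h : ∀ k ∈ K, t * k * t⁻¹ ∈ K) : K.Normal := by
  rw [← Subgroup.normalizer_eq_top_iff, eq_top_iff]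
  rintro g -
  obtain ⟨j, n, hn, rfl⟩ := hN.exists_zpow_mul_mem ht g
  refine mul_mem (zpow_mem (Subgroup.mem_normalizer_fintype h) j)
    (Subgroup.mem_normalizer_fintype fun k hk => ?_)
  rw [(hN.commute hG hn (hK hk)).eq, mul_inv_cancel_right]
  exact hk

omit [Finite G] in
theorem IsBlockKernel.exists_notMem (hN : IsBlockKernel p X N) : ∃ t, t ∉ N := by
  by_contra! h
  have h1 : N = ⊤ := eq_top_iff.2 fun g _ => h g
  have h2 := hN.index_eq
  rw [h1, Subgroup.index_top] at h2
  exact hp.out.one_lt.ne h2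

omit [Finite G] in
theorem conj_mem_stabilizer_smul {t k : G} {x : X} :
    t * k * t⁻¹ ∈ MulAction.stabilizer G (t • x) ↔ k ∈ MulAction.stabilizer G x := by
  simp [MulAction.mem_stabilizer_iff, mul_smul]

/-- An element with a fixed point has a canonical lift, vanishing at all its fixed points. Write `z
= h₀ h₁` with `hᵢ` fixing `xᵢ`. The product of the two canonical lifts is compared with its
conjugate by the lift of `t` through auxiliary elements fixing two of `x₀, x₁, x₂`; a stabilizer of
order greater than `p` leaves room for these. -/
theorem IsBlockKernel.trivialOn_top_of_lt_card_stabilizer [FaithfulSMul G X]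
    [MulAction.IsPretransitive G X] (hN : IsBlockKernel p X N) (hG : IsPGroup p G) (x₀ : X)
    (hc : IsProjCocycle c) (hS : ConstOnFixed c)
    (hcard : p < Nat.card (MulAction.stabilizer G x₀)) : TrivialOn ⊤ c := by
  obtain ⟨t, ht⟩ := hN.exists_notMem
  obtain ⟨z, hz, hz1, hzc⟩ := hN.exists_central hG x₀
  have hle := hN.stabilizer_le
  have hcm : ∀ {a b : G}, a ∈ N → b ∈ N → a * b = b * a := fun ha hb => hN.commute hG ha hb
  let x₁ := t • x₀
  let x₂ := t • x₁
  -- Otherwise `t` would normalize the stabilizer of `x₀`, which would be normal in `G` and hence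
  -- trivial.
  have hA : ∃ e ∈ MulAction.stabilizer G x₁, e ∉ MulAction.stabilizer G x₀ := by
    by_contra! h
    have := hN.normal_of_conj_mem hG (hle x₀) ht
      fun k hk => h _ (conj_mem_stabilizer_smul.2 hk)
    have := eq_bot_of_normal_le_stabilizer _ x₀ (le_refl (MulAction.stabilizer G x₀))
    rw [this, Subgroup.card_bot] at hcard
    exact hp.out.one_lt.not_gt hcard
  obtain ⟨e, he₁, he₀⟩ := hA
  -- Otherwise the intersection of the first two stabilizers would be normal, hence trivial, and the
  -- stabilizer of `x₀` would have order at most `p`.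
  have hB : ∃ d, d ∈ MulAction.stabilizer G x₀ ∧ d ∈ MulAction.stabilizer G x₁ ∧
      d ∉ MulAction.stabilizer G x₂ := by
    by_contra! h
    have ht' : t⁻¹ ∉ N := fun h => ht (by simpa using inv_mem h)
    have hn := hN.normal_of_conj_mem hG
      (K := MulAction.stabilizer G x₀ ⊓ MulAction.stabilizer G x₁)
      (inf_le_left.trans (hle x₀)) ht' (by
        rintro k ⟨hk₀, hk₁⟩
        have e0 : x₀ = t⁻¹ • x₁ := (inv_smul_smul t x₀).symm
        have e1 : x₁ = t⁻¹ • x₂ := (inv_smul_smul t x₁).symm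
        refine ⟨?_, ?_⟩
        · rw [e0]
          exact conj_mem_stabilizer_smul.2 hk₁
        · rw [e1]
          exact conj_mem_stabilizer_smul.2 (h k hk₀ hk₁))
    have hbot := eq_bot_of_normal_le_stabilizer _ x₀
      (inf_le_left : MulAction.stabilizer G x₀ ⊓ MulAction.stabilizer G x₁ ≤ _)
    have h1 : (MulAction.stabilizer G x₁).relIndex (MulAction.stabilizer G x₀) ≤ p := by
      have h2 := hN.relIndex_eq x₁
      rw [← h2]
      exact Subgroup.relIndex_le_of_le_right (hle x₀) (by rw [h2]; exact hp.out.ne_zero)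
    rw [← Subgroup.inf_relIndex_left, hbot, Subgroup.relIndex_bot_left] at h1
    omega
  obtain ⟨d, hd₀, hd₁, hd₂⟩ := hB
  have hC : ∀ n ∈ N, ∃ a ∈ MulAction.stabilizer G x₀, ∃ b ∈ MulAction.stabilizer G x₁,
      n = a * b := by
    intro n hn
    obtain ⟨j, hj⟩ := hN.exists_zpow_mul_mem_stabilizer hG x₀ (hle x₁ he₁) he₀ hn
    refine ⟨_, hj, e ^ (-j), zpow_mem he₁ _, ?_⟩
    rw [hcm (hle x₀ hj) (hle x₁ (zpow_mem he₁ _))]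
    group
  obtain ⟨h₀, hh₀, h₁, hh₁, hzh⟩ := hC z hz
  have hh₂ : t * h₁ * t⁻¹ ∈ MulAction.stabilizer G x₂ := conj_mem_stabilizer_smul.2 hh₁
  have hh₁' : t * h₀ * t⁻¹ ∈ MulAction.stabilizer G x₁ := conj_mem_stabilizer_smul.2 hh₀
  obtain ⟨a₀, ha₀, a₁, ha₁, haa⟩ := hC _ (hle x₂ hh₂)
  -- A power of `d`, which fixes `x₀` and `x₁`, is moved from one factor of `t h₁ t⁻¹ = a₀ a₁` to
  -- the other so that both also fix `x₂`.
  obtain ⟨j, hj⟩ := hN.exists_zpow_mul_mem_stabilizer hG x₂ (hle x₀ hd₀) hd₂ (hle x₀ ha₀)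
  have hk₀ : d ^ j * a₀ ∈ MulAction.stabilizer G x₀ := mul_mem (zpow_mem hd₀ _) ha₀
  have hk₁ : d ^ (-j) * a₁ ∈ MulAction.stabilizer G x₁ := mul_mem (zpow_mem hd₁ _) ha₁
  have hkk : (d ^ j * a₀) * (d ^ (-j) * a₁) = t * h₁ * t⁻¹ := by
    rw [haa, hcm (hle x₀ (zpow_mem hd₀ j)) (hle x₀ ha₀)]
    group
  have hk₁' : d ^ (-j) * a₁ ∈ MulAction.stabilizer G x₂ := by
    have : d ^ (-j) * a₁ = (d ^ j * a₀)⁻¹ * (t * h₁ * t⁻¹) := by rw [← hkk]; group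
    rw [this]
    exact mul_mem (inv_mem hj) hh₂
  generalize d ^ j * a₀ = k₀ at *
  generalize d ^ (-j) * a₁ = k₁ at *
  obtain ⟨e₀, he₀, he₀', hr₀⟩ := exists_mem_fixator hc hh₀
  obtain ⟨e₁, he₁, he₁', hr₁⟩ := exists_mem_fixator hc hh₁
  obtain ⟨g₀, hg₀, hg₀', hs₀⟩ := exists_mem_fixator hc hk₀
  obtain ⟨g₁, hg₁, hg₁', hs₁⟩ := exists_mem_fixator hc hk₁
  let T : Monomial G X := ⟨c t, t⟩
  have hT : T ∈ extGroup c hc := lift_mem t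
  have hf₀ : T * e₀ * T⁻¹ ∈ fixator x₁ := conj_mem_fixator he₀' T
  have hf₁ : T * e₁ * T⁻¹ ∈ fixator x₂ := conj_mem_fixator he₁' T
  have hf₀E : T * e₀ * T⁻¹ ∈ extGroup c hc := mul_mem (mul_mem hT he₀) (inv_mem hT)
  have hf₁E : T * e₁ * T⁻¹ ∈ extGroup c hc := mul_mem (mul_mem hT he₁) (inv_mem hT)
  have h1 : T * e₁ * T⁻¹ = g₀ * g₁ := by
    refine eq_of_mem_fixator hf₁E (mul_mem hg₀ hg₁) ?_ hf₁
      (mul_mem (hS.mem_fixator hg₀ hg₀' ?_) (hS.mem_fixator hg₁ hg₁' ?_))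
    · simp [hr₁, hs₀, hs₁, hkk, T]
    · rw [hs₀]
      exact hj
    · rw [hs₁]
      exact hk₁'
  have hrel : k₀⁻¹ * h₀ = t * h₀ * t⁻¹ * k₁ * h₁⁻¹ := by
    have h2 : t * z * t⁻¹ = z := by rw [← (hzc t).eq, mul_inv_cancel_right]
    have h3 : t * z * t⁻¹ = (t * h₀ * t⁻¹) * (k₀ * k₁) := by rw [hkk, hzh]; group
    have h4 : (t * h₀ * t⁻¹) * k₀ = k₀ * (t * h₀ * t⁻¹) := hcm (hle x₁ hh₁') (hle x₀ hk₀)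
    rw [h2, ← mul_assoc, h4, hzh] at h3
    rw [eq_mul_inv_iff_mul_eq, mul_assoc, h3]
    group
  -- The left side fixes `x₀` and the right side `x₁`. They lie over the same element by `hrel`, so
  -- both are its canonical lift.
  have h2 : g₀⁻¹ * e₀ = T * e₀ * T⁻¹ * g₁ * e₁⁻¹ := by
    have hm : T * e₀ * T⁻¹ * g₁ * e₁⁻¹ ∈ fixator x₁ :=
      mul_mem (mul_mem hf₀ hg₁') (inv_mem he₁')
    have hE : T * e₀ * T⁻¹ * g₁ * e₁⁻¹ ∈ extGroup c hc :=
      mul_mem (mul_mem hf₀E hg₁) (inv_mem he₁)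
    have hr : (g₀⁻¹ * e₀).right = (T * e₀ * T⁻¹ * g₁ * e₁⁻¹).right := by
      simp [hr₀, hr₁, hs₀, hs₁, hrel, T]
    refine eq_of_mem_fixator (mul_mem (inv_mem hg₀) he₀) hE hr
      (hS.mem_fixator (mul_mem (inv_mem hg₀) he₀) (mul_mem (inv_mem hg₀') he₀') ?_) hm
    rw [hr]
    exact hm.1
  have h3 : Commute g₀ (T * e₀ * T⁻¹) := by
    refine hS.commute hg₀ hf₀E hg₀'.1 ?_
    have : (T * e₀ * T⁻¹).right = t * h₀ * t⁻¹ := by simp [hr₀, T]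
    rw [this, hs₀]
    exact hcm (hle x₀ hk₀) (hle x₁ hh₁')
  have h4 : T * (e₀ * e₁) * T⁻¹ = e₀ * e₁ := by
    have h5 : e₀ * e₁ = g₀ * (T * e₀ * T⁻¹) * g₁ := by
      calc e₀ * e₁ = g₀ * (g₀⁻¹ * e₀) * e₁ := by group
        _ = _ := by rw [h2]; group
    have h6 : e₀ * e₁ = T * e₀ * T⁻¹ * (T * e₁ * T⁻¹) := by
      rw [h5, h3.eq, mul_assoc, h1]
    conv_rhs => rw [h6]
    group
  refine hN.trivialOn_top hG x₀ hc hS hz hz1 hzc ht ?_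
  refine commute_of_commute_of_right_eq (mul_mem he₀ he₁) (lift_mem z) hT (lift_mem t) ?_ rfl ?_
  · simp [hr₀, hr₁, hzh]
  · rw [mul_inv_eq_iff_eq_mul] at h4
    exact h4.symm

-- A trivialization `u` over `K` yields a multiplicative section `L`, which takes canonical values
-- on elements with a fixed point. Conjugation by the lift of `t` preserves canonical lifts of
-- elements of `K`, hence fixes `L h₀ * L h₁`, a lift of `h₀ * h₁`.
omit [Finite G] in
theorem commute_lift_of_trivialOn_of_eq_mul {K : Subgroup G} (hc : IsProjCocycle c)
    (hK : TrivialOn K c) {t : G} (ht : ∀ k ∈ K, t * k * t⁻¹ ∈ K) {h₀ h₁ : G} (hh₀ : h₀ ∈ K)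
    (hh₁ : h₁ ∈ K) {v₀ v₁ : X} (hv₀ : h₀ • v₀ = v₀) (hv₁ : h₁ • v₁ = v₁)
    (hcomm : Commute (h₀ * h₁) t) :
    Commute (⟨c (h₀ * h₁), h₀ * h₁⟩ : Monomial G X) ⟨c t, t⟩ := by
  obtain ⟨u, hu⟩ := hK
  let L : G → Monomial G X := fun k => ⟨fun y => u y - u (k⁻¹ • y), k⟩
  have hLE : ∀ k ∈ K, L k ∈ extGroup c hc := by
    intro k hk
    obtain ⟨a, ha⟩ := hu k hk
    refine ⟨-a, fun y => ?_⟩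
    rw [ha]
    simp [L]
  have hLmul : ∀ k k', L (k * k') = L k * L k' := fun k k' =>
    Monomial.ext (funext fun y => by simp [L, mul_smul]) rfl
  have hLfix : ∀ k (v : X), k • v = v → L k ∈ fixator v := fun k v hv =>
    ⟨hv, by simp [L, inv_smul_eq_iff.2 hv.symm]⟩
  let T : Monomial G X := ⟨c t, t⟩
  have hT : T ∈ extGroup c hc := lift_mem t
  have hconj : ∀ k ∈ K, ∀ v : X, k • v = v → T * L k * T⁻¹ = L (t * k * t⁻¹) := by
    intro k hk v hv
    refine eq_of_mem_fixator (v := t • v) (mul_mem (mul_mem hT (hLE k hk)) (inv_mem hT))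
      (hLE _ (ht k hk)) rfl (conj_mem_fixator (hLfix k v hv) T) (hLfix _ _ ?_)
    simp [mul_smul, hv]
  have h1 : T * L (h₀ * h₁) * T⁻¹ = L (h₀ * h₁) := by
    have h2 : t * (h₀ * h₁) * t⁻¹ = h₀ * h₁ := by rw [← hcomm.eq, mul_inv_cancel_right]
    calc T * L (h₀ * h₁) * T⁻¹ = (T * L h₀ * T⁻¹) * (T * L h₁ * T⁻¹) := by rw [hLmul]; group
      _ = L ((t * h₀ * t⁻¹) * (t * h₁ * t⁻¹)) := by
        rw [hconj _ hh₀ _ hv₀, hconj _ hh₁ _ hv₁, hLmul (t * h₀ * t⁻¹)]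
      _ = L (h₀ * h₁) := by rw [← h2]; congr 1; group
  rw [mul_inv_eq_iff_eq_mul] at h1
  exact commute_of_commute_of_right_eq (hLE _ (mul_mem hh₀ hh₁)) (lift_mem _) hT (lift_mem t) rfl
    rfl h1.symm

end Large

/-! ### Triviality on subgroups generated by an element with trivial `p`-th power. -/

section Cyclic

variable {G : Type} [Group G] {X : Type} [MulAction G X] {c : G → X → AddCircle (1 : ℚ)}

/-- Let `u y` be the value at `y` of a power of `w` carrying the chosen base point of the orbit to
`y`. The choice of power is immaterial because a power fixing a point vanishes there. -/
theorem exists_eq_sub_of_pow_eq_one {p : ℕ} (hp : p.Prime) (w : Monomial G X) (hw : w ^ p = 1)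
    (h0 : ∀ v, w.right • v = v → w.left v = 0) :
    ∃ u : X → AddCircle (1 : ℚ), ∀ y, w.left y = u y - u (w.right⁻¹ • y) := by
  have hfix : ∀ (k : ℤ) (v : X), w.right ^ k • v = v → (w ^ k).left v = 0 := by
    intro k v hv
    by_cases hk : (p : ℤ) ∣ k
    · obtain ⟨m, rfl⟩ := hk
      rw [zpow_mul, zpow_natCast, hw, one_zpow, one_left_apply]
    · have hcop : IsCoprime (p : ℤ) k :=
        (Nat.prime_iff_prime_int.1 hp).coprime_iff_not_dvd.2 hk
      -- By Bézout `w.right` is a power of `w.right ^ k`, so it also fixes `v`.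
      obtain ⟨a, b, hab⟩ := hcop
      have hr : w.right • v = v := by
        have h1 : w.right ^ (p : ℤ) = 1 := by
          rw [← zpow_right, zpow_natCast, hw, one_right]
        have h2 : w.right = (w.right ^ k) ^ b := by
          rw [← zpow_mul]
          conv_lhs => rw [← zpow_one w.right, ← hab, zpow_add, mul_comm a, zpow_mul, h1, one_zpow,
            one_mul, mul_comm b]
        rw [h2]
        exact MulAction.mem_stabilizer_iff.1
          (zpow_mem (MulAction.mem_stabilizer_iff.2 hv : w.right ^ k ∈ MulAction.stabilizer G v) b)
      have hm : w ∈ fixator v := ⟨hr, h0 v hr⟩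
      exact (zpow_mem hm k).2
  let s := MulAction.orbitRel (Subgroup.zpowers w.right) X
  have hrep : ∀ y : X, ∃ k : ℤ, w.right ^ k • (Quotient.out (Quotient.mk s y)) = y := by
    intro y
    have h1 : s y (Quotient.out (Quotient.mk s y)) := Setoid.symm (Quotient.mk_out y)
    obtain ⟨⟨_, k, rfl⟩, hg⟩ := h1
    exact ⟨k, hg⟩
  choose k hk using hrep
  refine ⟨fun y => (w ^ k y).left y, fun y => ?_⟩
  have hq : Quotient.mk s (w.right⁻¹ • y) = Quotient.mk s y :=
    Quotient.sound ⟨⟨w.right⁻¹, inv_mem (Subgroup.mem_zpowers _)⟩, rfl⟩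
  have h1 := hk (w.right⁻¹ • y)
  rw [hq] at h1
  have h2 : w.right ^ (k y - (k (w.right⁻¹ • y) + 1)) • y = y := by
    have h3 : w.right ^ (k (w.right⁻¹ • y) + 1) • (Quotient.out (Quotient.mk s y)) = y := by
      rw [add_comm, zpow_add, mul_smul, h1, zpow_one, smul_inv_smul]
    have h4 : Quotient.out (Quotient.mk s y) = w.right ^ (-(k (w.right⁻¹ • y) + 1)) • y := by
      rw [zpow_neg, eq_inv_smul_iff, h3]
    rw [sub_eq_add_neg, zpow_add, mul_smul, ← h4, hk]
  have h3 := hfix _ y h2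
  have h4 : w ^ k y = w ^ (k y - (k (w.right⁻¹ • y) + 1)) * (w * w ^ (k (w.right⁻¹ • y))) := by
    rw [← zpow_one_add, ← zpow_add]
    congr 1
    ring
  have h5 : (w ^ k y).left y = w.left y + (w ^ k (w.right⁻¹ • y)).left (w.right⁻¹ • y) := by
    rw [h4, mul_left_apply, h3, zero_add, zpow_right, inv_smul_eq_iff.2 h2.symm, mul_left_apply]
  change w.left y = (w ^ k y).left y - (w ^ k (w.right⁻¹ • y)).left (w.right⁻¹ • y)
  rw [h5, add_sub_cancel_right]

theorem trivialOn_zpowers_of_apply (hc : IsProjCocycle c) {g : G}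
    (u : X → AddCircle (1 : ℚ)) (a : AddCircle (1 : ℚ))
    (h : ∀ y, c g y = u y - u (g⁻¹ • y) + a) : TrivialOn (Subgroup.zpowers g) c := by
  let K : Subgroup (Monomial G X) :=
    { carrier := {w | ∃ a, ∀ y, w.left y = u y - u (w.right⁻¹ • y) + a}
      mul_mem' := by
        rintro w w' ⟨a, ha⟩ ⟨b, hb⟩
        refine ⟨a + b, fun y => ?_⟩
        rw [mul_left_apply, Monomial.mul_right, ha, hb, mul_inv_rev, mul_smul]
        abel
      one_mem' := ⟨0, by simp⟩
      inv_mem' := by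
        rintro w ⟨a, ha⟩
        refine ⟨-a, fun y => ?_⟩
        rw [inv_left_apply, inv_right, ha, inv_inv, inv_smul_smul]
        abel }
  have hK : (⟨c g, g⟩ : Monomial G X) ∈ K := ⟨a, h⟩
  refine ⟨u, fun g' hg' => ?_⟩
  obtain ⟨k, rfl⟩ := Subgroup.mem_zpowers_iff.1 hg'
  obtain ⟨b, hb⟩ := zpow_mem hK k
  obtain ⟨e, he⟩ := zpow_mem (lift_mem (hc := hc) g) k
  refine ⟨b - e, fun y => ?_⟩
  have h1 := (he y).symm.trans (hb y)
  rw [zpow_right] at h1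
  rw [← eq_sub_iff_add_eq] at h1
  rw [h1]
  abel

/-- The lift of `g` is rescaled to have `p`-th power `1`: by its value at a fixed point if there is
one, otherwise by dividing by `p` in `ℚ/ℤ`. -/
theorem ConstOnFixed.trivialOn_zpowers (hS : ConstOnFixed c) (hc : IsProjCocycle c) {p : ℕ}
    (hp : p.Prime) {g : G} (hg : g ^ p = 1) : TrivialOn (Subgroup.zpowers g) c := by
  obtain ⟨κ, hκ, hκ0⟩ : ∃ κ, (scalar κ * (⟨c g, g⟩ : Monomial G X)) ^ p = 1 ∧
      ∀ v, g • v = v → (scalar κ * (⟨c g, g⟩ : Monomial G X)).left v = 0 := by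
    by_cases h : ∃ v : X, g • v = v
    · obtain ⟨v, hv⟩ := h
      have hm : scalar (Multiplicative.ofAdd (-c g v)) * (⟨c g, g⟩ : Monomial G X) ∈ fixator v :=
        ⟨by simp [hv], by simp⟩
      have hE : scalar (Multiplicative.ofAdd (-c g v)) * (⟨c g, g⟩ : Monomial G X) ∈
        extGroup c hc := mul_mem (scalar_mem _) (lift_mem g)
      refine ⟨Multiplicative.ofAdd (-c g v), ?_, fun v' hv' => ?_⟩
      · exact eq_of_mem_fixator (pow_mem hE p) (one_mem _) (by simp [hg]) (pow_mem hm p) (one_mem _)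
      · exact (hS.mem_fixator hE hm (by simpa using hv')).2
    · obtain ⟨a, ha⟩ := exists_eq_scalar_mul (pow_mem (lift_mem (hc := hc) g) p)
        (one_mem _) (by simp [hg])
      obtain ⟨q, hq⟩ := QuotientAddGroup.mk_surjective a.toAdd
      have hp0 : (p : ℚ) ≠ 0 := by exact_mod_cast hp.ne_zero
      refine ⟨Multiplicative.ofAdd ((-q / p : ℚ) : AddCircle (1 : ℚ)), ?_,
        fun v hv => (h ⟨v, hv⟩).elim⟩
      rw [(scalar_commute _ _).mul_pow, ha, mul_one, ← map_pow, ← map_mul]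
      have h1 : Multiplicative.ofAdd ((-q / p : ℚ) : AddCircle (1 : ℚ)) ^ p * a = 1 := by
        apply Multiplicative.toAdd.injective
        rw [toAdd_mul, toAdd_pow, toAdd_ofAdd, ← hq, ← AddCircle.coe_nsmul]
        have : p • (-q / p : ℚ) = -q := by rw [nsmul_eq_mul]; field_simp
        rw [this, AddCircle.coe_neg]
        exact neg_add_cancel _
      rw [h1, map_one]
  obtain ⟨u, hu⟩ := exists_eq_sub_of_pow_eq_one hp _ hκ (fun v hv => hκ0 v (by simpa using hv))
  refine trivialOn_zpowers_of_apply hc u (-κ.toAdd) fun y => ?_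
  have := hu y
  simp only [mul_left_apply, scalar_left_apply, scalar_right, inv_one, one_smul,
    Monomial.mul_right, one_mul] at this
  rw [← this]
  abel

end Cyclic

/-! ### Powers with exponents in `ZMod p` -/

section ZModPow

variable {p : ℕ} {Γ : Type*} [Group Γ]

/-- The powers of an element `a` with `a ^ p = 1`, with exponents in `ZMod p`. -/
def zmodPow {a : Γ} (ha : a ^ p = 1) : Multiplicative (ZMod p) →* Γ :=
  AddMonoidHom.toMultiplicativeLeft (ZMod.lift p ⟨zmultiplesHom (Additive Γ) (Additive.ofMul a), by
    simp [← ofMul_pow, ha]⟩)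

theorem zmodPow_natCast {a : Γ} (ha : a ^ p = 1) (n : ℕ) :
    zmodPow ha (Multiplicative.ofAdd (n : ZMod p)) = a ^ n := by
  have h := ZMod.lift_coe p (⟨zmultiplesHom (Additive Γ) (Additive.ofMul a), by
    simp [← ofMul_pow, ha]⟩ : {f : ℤ →+ Additive Γ // f p = 0}) n
  rw [Int.cast_natCast] at h
  change Additive.toMul _ = _
  erw [h]
  simp [← ofMul_pow]
  rfl

theorem zmodPow_one {a : Γ} (ha : a ^ p = 1) :
    zmodPow ha (Multiplicative.ofAdd (1 : ZMod p)) = a := by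
  simpa using zmodPow_natCast ha 1

theorem zmodPow_mem {a : Γ} (ha : a ^ p = 1) [NeZero p] (x : Multiplicative (ZMod p))
    {S : Subgroup Γ} (h : a ∈ S) : zmodPow ha x ∈ S := by
  obtain ⟨n, hn⟩ := ZMod.natCast_zmod_surjective x.toAdd
  have : x = Multiplicative.ofAdd (n : ZMod p) := by rw [hn]; rfl
  rw [this, zmodPow_natCast]
  exact pow_mem h n

theorem zmodPow_commute {a b : Γ} (ha : a ^ p = 1) (hb : b ^ p = 1) [NeZero p] (h : Commute a b)
    (x y : Multiplicative (ZMod p)) : Commute (zmodPow ha x) (zmodPow hb y) := by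
  obtain ⟨n, hn⟩ := ZMod.natCast_zmod_surjective x.toAdd
  obtain ⟨m, hm⟩ := ZMod.natCast_zmod_surjective y.toAdd
  have h1 : x = Multiplicative.ofAdd (n : ZMod p) := by rw [hn]; rfl
  have h2 : y = Multiplicative.ofAdd (m : ZMod p) := by rw [hm]; rfl
  rw [h1, h2, zmodPow_natCast, zmodPow_natCast]
  exact h.pow_pow n m

theorem zmodPow_eq_one_iff [hp : Fact p.Prime] {a : Γ} (ha : a ^ p = 1) (ha1 : a ≠ 1)
    (x : ZMod p) : zmodPow ha (Multiplicative.ofAdd x) = 1 ↔ x = 0 := by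
  refine ⟨fun h => ?_, fun h => by rw [h, ofAdd_zero, map_one]⟩
  obtain ⟨n, rfl⟩ := ZMod.natCast_zmod_surjective x
  rw [zmodPow_natCast] at h
  rw [ZMod.natCast_eq_zero_iff, ← orderOf_eq_prime ha ha1]
  exact orderOf_dvd_of_pow_eq_one h

theorem pow_mul_pow_of_mul_eq {a b c : Γ} (hca : Commute c a) (hcb : Commute c b)
    (hab : a * b = b * a * c) (m n : ℕ) : a ^ m * b ^ n = b ^ n * a ^ m * c ^ (m * n) := by
  have h1 : ∀ m : ℕ, a ^ m * b = b * a ^ m * c ^ m := by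
    intro m
    induction m with
    | zero => simp
    | succ m ih =>
      rw [pow_succ, mul_assoc, hab, ← mul_assoc, ← mul_assoc, ih,
        pow_succ c, mul_assoc _ (c ^ m) a, (hca.pow_left m).eq]
      simp only [mul_assoc]
  induction n with
  | zero => simp
  | succ n ih =>
    rw [pow_succ, ← mul_assoc, ih, mul_assoc, (hcb.pow_left _).eq, ← mul_assoc,
      mul_assoc (b ^ n), h1, mul_add, mul_one, add_comm, pow_add]
    simp only [mul_assoc]

theorem zmodPow_mul_zmodPow [NeZero p] {a b c : Γ} (ha : a ^ p = 1) (hb : b ^ p = 1)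
    (hc : c ^ p = 1) (hca : Commute c a) (hcb : Commute c b) (hab : a * b = b * a * c)
    (x y : ZMod p) :
    zmodPow ha (Multiplicative.ofAdd x) * zmodPow hb (Multiplicative.ofAdd y) =
      zmodPow hb (Multiplicative.ofAdd y) * zmodPow ha (Multiplicative.ofAdd x) *
        zmodPow hc (Multiplicative.ofAdd (x * y)) := by
  obtain ⟨m, rfl⟩ := ZMod.natCast_zmod_surjective x
  obtain ⟨n, rfl⟩ := ZMod.natCast_zmod_surjective y
  rw [← Nat.cast_mul, zmodPow_natCast, zmodPow_natCast, zmodPow_natCast,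
    pow_mul_pow_of_mul_eq hca hcb hab]

end ZModPow

/-! ### The Heisenberg group -/

section Heisenberg

variable {p : ℕ}

/-- The matrix with coordinates `x`, `y`, `z` in the Heisenberg group. -/
def heisMk (x y z : ZMod p) : heisenberg p :=
  ⟨⟨!![1, x, z; 0, 1, y; 0, 0, 1], by simp [Matrix.det_fin_three]⟩, x, y, z, rfl⟩

theorem heisMk_surjective (A : heisenberg p) : ∃ x y z, heisMk x y z = A := by
  obtain ⟨A, x, y, z, h⟩ := A
  exact ⟨x, y, z, Subtype.ext (Subtype.ext h.symm)⟩

/-- The coordinate `x` on the Heisenberg group. -/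
def heisX (A : heisenberg p) : ZMod p := A.1.1 0 1
/-- The coordinate `y` on the Heisenberg group. -/
def heisY (A : heisenberg p) : ZMod p := A.1.1 1 2
/-- The coordinate `z` on the Heisenberg group. -/
def heisZ (A : heisenberg p) : ZMod p := A.1.1 0 2

@[simp] theorem heisX_mk (x y z : ZMod p) : heisX (heisMk x y z) = x := rfl
@[simp] theorem heisY_mk (x y z : ZMod p) : heisY (heisMk x y z) = y := rfl
@[simp] theorem heisZ_mk (x y z : ZMod p) : heisZ (heisMk x y z) = z := rfl

theorem heisMk_mul (x y z x' y' z' : ZMod p) :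
    heisMk x y z * heisMk x' y' z' = heisMk (x + x') (y + y') (z + z' + x * y') := by
  refine Subtype.ext (Subtype.ext ?_)
  change !![1, x, z; 0, 1, y; 0, 0, 1] * !![1, x', z'; 0, 1, y'; 0, 0, 1] =
    !![1, x + x', z + z' + x * y'; 0, 1, y + y'; 0, 0, 1]
  ext i j
  fin_cases i <;> fin_cases j <;> simp [Matrix.mul_apply, Fin.sum_univ_three] <;> ring

theorem heisMk_coords (A : heisenberg p) : heisMk (heisX A) (heisY A) (heisZ A) = A := by
  obtain ⟨x, y, z, rfl⟩ := heisMk_surjective A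
  rfl

theorem heisMk_zero : (heisMk 0 0 0 : heisenberg p) = 1 := by
  refine Subtype.ext (Subtype.ext ?_)
  ext i j
  fin_cases i <;> fin_cases j <;> simp [heisMk]

theorem card_heisenberg [NeZero p] : Nat.card (heisenberg p) = p ^ 3 := by
  have e : heisenberg p ≃ ZMod p × ZMod p × ZMod p :=
    { toFun := fun A => (heisX A, heisY A, heisZ A)
      invFun := fun x => heisMk x.1 x.2.1 x.2.2
      left_inv := heisMk_coords
      right_inv := fun _ => rfl }
  rw [Nat.card_congr e, Nat.card_prod, Nat.card_prod, Nat.card_zmod]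
  ring

/-- The homomorphism from the Heisenberg group attached to elements `a`, `b` of order dividing
`p` whose commutator `c` is central. -/
theorem exists_heisenberg_hom [NeZero p] {Γ : Type*} [Group Γ] {a b c : Γ} (ha : a ^ p = 1)
    (hb : b ^ p = 1) (hc : c ^ p = 1) (hca : Commute c a) (hcb : Commute c b)
    (hab : a * b = b * a * c) : ∃ φ : heisenberg p →* Γ, ∀ x y z, φ (heisMk x y z) =
      zmodPow hb (Multiplicative.ofAdd y) * zmodPow ha (Multiplicative.ofAdd x) *
        zmodPow hc (Multiplicative.ofAdd z) := by
  refine ⟨MonoidHom.mk' (fun A => zmodPow hb (Multiplicative.ofAdd (heisY A)) *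
    zmodPow ha (Multiplicative.ofAdd (heisX A)) *
        zmodPow hc (Multiplicative.ofAdd (heisZ A))) ?_, fun x y z => rfl⟩
  intro A B
  obtain ⟨x, y, z, rfl⟩ := heisMk_surjective A
  obtain ⟨x', y', z', rfl⟩ := heisMk_surjective B
  simp only [heisMk_mul, heisX_mk, heisY_mk, heisZ_mk, ofAdd_add, map_mul]
  have h1 := zmodPow_mul_zmodPow ha hb hc hca hcb hab x y'
  have h2 := fun u v => (zmodPow_commute hc ha hca u v).eq
  have h3 := fun u v => (zmodPow_commute hc hb hcb u v).eq
  have h4 : zmodPow hc (Multiplicative.ofAdd z) * (zmodPow hb (Multiplicative.ofAdd y') *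
      zmodPow ha (Multiplicative.ofAdd x') * zmodPow hc (Multiplicative.ofAdd z')) =
      zmodPow hb (Multiplicative.ofAdd y') * zmodPow ha (Multiplicative.ofAdd x') *
      (zmodPow hc (Multiplicative.ofAdd z) * zmodPow hc (Multiplicative.ofAdd z')) := by
    simp only [← mul_assoc]
    rw [h3, mul_assoc (zmodPow hb _) (zmodPow hc _), h2]
    simp only [← mul_assoc]
  have h5 := h2 (Multiplicative.ofAdd (x * y')) (Multiplicative.ofAdd x')
  rw [mul_assoc (_ * _) (zmodPow hc (Multiplicative.ofAdd z)), h4]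
  have h6 : zmodPow ha (Multiplicative.ofAdd x) * (zmodPow hb (Multiplicative.ofAdd y') *
      zmodPow ha (Multiplicative.ofAdd x')) = zmodPow hb (Multiplicative.ofAdd y') *
      (zmodPow ha (Multiplicative.ofAdd x) * zmodPow ha (Multiplicative.ofAdd x')) *
        zmodPow hc (Multiplicative.ofAdd (x * y')) := by
    rw [← mul_assoc, h1]
    simp only [mul_assoc]
    rw [h5]
  have h7 : ∀ u v, Commute (zmodPow hc u) (zmodPow hc v) :=
    fun u v => zmodPow_commute hc hc (Commute.refl c) u v
  have h8 : ∀ B A₁ B' A' C C' C'' : Γ, A₁ * (B' * A') = B' * (A₁ * A') * C'' →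
      Commute C'' (C * C') →
      B * B' * (A₁ * A') * (C * C' * C'') = B * A₁ * (B' * A' * (C * C')) := by
    intro B A₁ B' A' C C' C'' h h'
    rw [← h'.eq]
    simp only [← mul_assoc] at h ⊢
    rw [mul_assoc (B * A₁) B' A', mul_assoc B A₁, ← mul_assoc A₁, h]
    simp only [← mul_assoc]
  exact h8 _ _ _ _ _ _ _ h6 ((h7 _ _).mul_right (h7 _ _))

/-- The homomorphism from `(C_p)²` attached to two commuting elements of order dividing `p`. -/
theorem exists_cpSq_hom [NeZero p] {Γ : Type*} [Group Γ] {a b : Γ} (ha : a ^ p = 1)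
    (hb : b ^ p = 1) (hab : Commute a b) :
    ∃ φ : Multiplicative (ZMod p) × Multiplicative (ZMod p) →* Γ,
      ∀ x y, φ (x, y) = zmodPow ha x * zmodPow hb y :=
  ⟨(zmodPow ha).noncommCoprod (zmodPow hb) fun x y => zmodPow_commute ha hb hab x y,
    fun _ _ => rfl⟩

theorem card_cpSq [NeZero p] :
    Nat.card (Multiplicative (ZMod p) × Multiplicative (ZMod p)) = p ^ 2 := by
  rw [Nat.card_prod, Nat.card_congr Multiplicative.toAdd, Nat.card_zmod, pow_two]

end Heisenberg

/-! ### The groups `P'_1` and `P'_2` -/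

section PPrime

variable {p : ℕ}

/-- By Pascal's rule neighbouring entries of row `p - 1` add up to an entry of row `p`, which is
divisible by `p`. -/
theorem natCast_choose_prime_sub_one [hp : Fact p.Prime] (k : ℕ) (hk : k ≤ p - 1) :
    ((p - 1).choose k : ZMod p) = (-1) ^ k := by
  induction k with
  | zero => simp
  | succ k ih =>
    have h1 : p.choose (k + 1) = (p - 1).choose k + (p - 1).choose (k + 1) := by
      conv_lhs => rw [← Nat.sub_add_cancel hp.out.one_le]
      rw [Nat.choose_succ_succ]
    have h2 : ((p.choose (k + 1) : ℕ) : ZMod p) = 0 :=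
      (ZMod.natCast_eq_zero_iff _ _).2
        (hp.out.dvd_choose_self (Nat.succ_ne_zero k) (by have := hp.out.one_lt; omega))
    rw [h1, Nat.cast_add, ih (by omega)] at h2
    rw [eq_neg_of_add_eq_zero_right h2, pow_succ]
    ring

theorem natCast_choose_prime_sub_two [hp : Fact p.Prime] (k : ℕ) (hk : k ≤ p - 2) :
    ((p - 2).choose k : ZMod p) = (-1) ^ k * (k + 1) := by
  induction k with
  | zero => simp
  | succ k ih =>
    have h1 : (p - 1).choose (k + 1) = (p - 2).choose k + (p - 2).choose (k + 1) := by
      have : p - 1 = (p - 2) + 1 := by have := hp.out.two_le; omega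
      rw [this, Nat.choose_succ_succ]
    have h2 := natCast_choose_prime_sub_one (p := p) (k + 1) (by omega)
    rw [h1, Nat.cast_add, ih (by omega)] at h2
    rw [eq_sub_of_add_eq' h2]
    push_cast
    ring

theorem aCoeff_sub_one [hp : Fact p.Prime] (hp2 : 2 < p) (i : ZMod p) :
    (aCoeff (p - 1) i.val : ZMod p) = 1 := by
  have hi : i.val ≤ p - 1 := by have := ZMod.val_lt i; omega
  have hev : Even (p - 1) := hp.out.even_sub_one (by omega)
  rw [aCoeff, if_pos hi]
  push_cast
  rw [natCast_choose_prime_sub_one _ hi, ← pow_add, Nat.sub_add_cancel hi, hev.neg_one_pow]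

theorem aCoeff_sub_two [hp : Fact p.Prime] (hp2 : 2 < p) (i : ZMod p) :
    (aCoeff (p - 2) i.val : ZMod p) = -(i + 1) := by
  have hlt := ZMod.val_lt i
  have hodd : Odd (p - 2) := Nat.Odd.sub_even hp2.le (hp.out.odd_of_ne_two hp2.ne') even_two
  rw [aCoeff]
  split_ifs with hi
  · push_cast
    rw [natCast_choose_prime_sub_two _ hi, ← mul_assoc, ← pow_add, Nat.sub_add_cancel hi,
      hodd.neg_one_pow, ZMod.natCast_zmod_val]
    ring
  -- The remaining index is `p - 1`, where the coefficient is `0` by definition, in agreement with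
  -- `i + 1 = 0`.
  · have h1 : i.val + 1 = p := by omega
    have h2 : i + 1 = 0 := by
      rw [← ZMod.natCast_zmod_val i, ← Nat.cast_succ, Nat.succ_eq_add_one, h1, ZMod.natCast_self]
    rw [h2]
    simp

theorem zPerm_zpow_apply (i₀ i j : ZMod p) (k : ℤ) :
    (zPerm p i₀ ^ k) (i, j) = (i, j + if i = i₀ then (k : ZMod p) else 0) := by
  have h1 : ∀ j, zPerm p i₀ (i, j) = (i, j + if i = i₀ then 1 else 0) := by
    intro j
    change (if i = i₀ then (i, j + 1) else (i, j)) = _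
    split_ifs <;> simp
  have h2 : ∀ j, (zPerm p i₀)⁻¹ (i, j) = (i, j - if i = i₀ then 1 else 0) := by
    intro j
    rw [Equiv.Perm.inv_eq_iff_eq, h1]
    simp
  induction k with
  | zero => simp
  | succ k ih =>
    rw [add_comm, zpow_one_add, Equiv.Perm.mul_apply, ih, h1]
    split_ifs <;> simp [add_assoc, add_comm]
  | pred k ih =>
    rw [sub_eq_neg_add, zpow_add, zpow_neg_one, Equiv.Perm.mul_apply, ih, h2]
    split_ifs <;> simp [sub_eq_add_neg, add_assoc, add_comm]

theorem prod_range_zPerm_apply [NeZero p] (a : ℕ → ℤ) (m : ℕ) (hm : m ≤ p) (i j : ZMod p) :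
    ((List.range m).map fun j : ℕ => zPerm p (j : ZMod p) ^ a j).prod (i, j) =
      (i, j + if i.val < m then (a i.val : ZMod p) else 0) := by
  induction m generalizing j with
  | zero => simp
  | succ m ih =>
    rw [List.range_succ, List.map_append, List.prod_append, Equiv.Perm.mul_apply]
    simp only [List.map_cons, List.map_nil, List.prod_cons, List.prod_nil, mul_one]
    rw [zPerm_zpow_apply, ih (by omega)]
    have h1 : i = (m : ZMod p) ↔ i.val = m := by
      constructor
      · rintro rfl
        exact ZMod.val_cast_of_lt (by omega)
      · intro h
        rw [← h, ZMod.natCast_zmod_val]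
    simp only [h1]
    rcases lt_trichotomy i.val m with h | h | h
    · simp [h, h.ne, h.trans (Nat.lt_succ_self m)]
    · subst h
      simp
    · simp [h.ne', h.not_gt, show ¬ i.val < m + 1 by omega]

theorem gammaPerm_apply [NeZero p] (n : ℕ) (i j : ZMod p) :
    gammaPerm p n (i, j) = (i, j + aCoeff (p - n) i.val) := by
  rw [gammaPerm, prod_range_zPerm_apply _ p le_rfl, if_pos (ZMod.val_lt i)]

theorem rho₁_apply (i j : ZMod p) : rho₁ p (i, j) = (i, j + 1) := rfl
theorem rho₂_apply (i j : ZMod p) : rho₂ p (i, j) = (i + 1, j) := rfl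

theorem rho₁_pow_apply (n : ℕ) (i j : ZMod p) : (rho₁ p ^ n) (i, j) = (i, j + n) := by
  induction n generalizing j with
  | zero => simp
  | succ n ih => rw [pow_succ, Equiv.Perm.mul_apply, rho₁_apply, ih]; push_cast; simp; ring

theorem rho₂_pow_apply (n : ℕ) (i j : ZMod p) : (rho₂ p ^ n) (i, j) = (i + n, j) := by
  induction n generalizing i with
  | zero => simp
  | succ n ih => rw [pow_succ, Equiv.Perm.mul_apply, rho₂_apply, ih]; push_cast; simp; ring

theorem gammaPerm_two_pow_apply [Fact p.Prime] (hp2 : 2 < p) (n : ℕ) (i j : ZMod p) :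
    (gammaPerm p 2 ^ n) (i, j) = (i, j - n * (i + 1)) := by
  induction n generalizing j with
  | zero => simp
  | succ n ih =>
    rw [pow_succ, Equiv.Perm.mul_apply, gammaPerm_apply, aCoeff_sub_two hp2, ih]
    push_cast
    simp
    ring

theorem rho₁_pow_prime : rho₁ p ^ p = 1 :=
  Equiv.ext fun ⟨i, j⟩ => by simp [rho₁_pow_apply]

theorem rho₂_pow_prime : rho₂ p ^ p = 1 :=
  Equiv.ext fun ⟨i, j⟩ => by simp [rho₂_pow_apply]

theorem nonempty_PPrime_one_equiv [hp : Fact p.Prime] (hp2 : 2 < p) :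
    Nonempty (PPrime p 1 ≃* Multiplicative (ZMod p) × Multiplicative (ZMod p)) := by
  have hcomm : Commute (rho₁ p) (rho₂ p) := Equiv.ext fun ⟨i, j⟩ => rfl
  have hγ : gammaPerm p 1 = rho₁ p := Equiv.ext fun ⟨i, j⟩ => by
    rw [gammaPerm_apply, aCoeff_sub_one hp2, rho₁_apply]
  obtain ⟨φ, hφ⟩ := exists_cpSq_hom (p := p) rho₁_pow_prime rho₂_pow_prime hcomm
  have hφ' : ∀ m n : ℕ, φ (Multiplicative.ofAdd (m : ZMod p), Multiplicative.ofAdd (n : ZMod p)) =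
      rho₁ p ^ m * rho₂ p ^ n := fun m n => by
    rw [hφ, zmodPow_natCast, zmodPow_natCast]
  have hinj : Function.Injective φ := by
    rw [injective_iff_map_eq_one]
    rintro ⟨x, y⟩ h
    obtain ⟨m, hm⟩ := ZMod.natCast_zmod_surjective x.toAdd
    obtain ⟨n, hn⟩ := ZMod.natCast_zmod_surjective y.toAdd
    have hx : x = Multiplicative.ofAdd (m : ZMod p) := by rw [hm]; rfl
    have hy : y = Multiplicative.ofAdd (n : ZMod p) := by rw [hn]; rfl
    rw [hx, hy, hφ'] at h
    have h1 := Equiv.congr_fun h ((0 : ZMod p), (0 : ZMod p))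
    rw [Equiv.Perm.mul_apply, rho₂_pow_apply, rho₁_pow_apply] at h1
    simp only [zero_add, Equiv.Perm.coe_one, id_eq, Prod.mk.injEq] at h1
    rw [hx, hy, h1.1, h1.2]
    rfl
  have hrange : φ.range = PPrime p 1 := by
    apply le_antisymm
    · rintro _ ⟨⟨x, y⟩, rfl⟩
      rw [hφ]
      exact mul_mem (zmodPow_mem _ _ (Subgroup.subset_closure (by simp)))
        (zmodPow_mem _ _ (Subgroup.subset_closure (by simp)))
    · rw [PPrime, Subgroup.closure_le]
      rintro _ (rfl | rfl | rfl)
      · exact ⟨(Multiplicative.ofAdd ((1 : ℕ) : ZMod p), Multiplicative.ofAdd ((0 : ℕ) : ZMod p)),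
          by rw [hφ']; simp⟩
      · exact ⟨(Multiplicative.ofAdd ((0 : ℕ) : ZMod p), Multiplicative.ofAdd ((1 : ℕ) : ZMod p)),
          by rw [hφ']; simp⟩
      · exact ⟨(Multiplicative.ofAdd ((1 : ℕ) : ZMod p), Multiplicative.ofAdd ((0 : ℕ) : ZMod p)),
          by rw [hφ', hγ]; simp⟩
  exact ⟨((MonoidHom.ofInjective hinj).trans (MulEquiv.subgroupCongr hrange)).symm⟩

/-- Modulo `p` the exponents of `γ_2` are `-(i + 1)`, affine in `i`, so its commutator with the
shift `ρ₂` is the central `ρ₁`: these are the Heisenberg relations. -/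
theorem nonempty_PPrime_two_equiv [hp : Fact p.Prime] (hp2 : 2 < p) :
    Nonempty (PPrime p 2 ≃* heisenberg p) := by
  have hγ : ∀ i j, gammaPerm p 2 (i, j) = (i, j - (i + 1)) := fun i j => by
    rw [gammaPerm_apply, aCoeff_sub_two hp2, sub_eq_add_neg]
  have hγp : gammaPerm p 2 ^ p = 1 := Equiv.ext fun ⟨i, j⟩ => by
    simp [gammaPerm_two_pow_apply hp2]
  have hca : Commute (rho₁ p) (rho₂ p) := Equiv.ext fun ⟨i, j⟩ => rfl
  have hcb : Commute (rho₁ p) (gammaPerm p 2) := Equiv.ext fun ⟨i, j⟩ => by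
    simp only [Equiv.Perm.mul_apply, hγ, rho₁_apply]
    ext <;> simp
    ring
  have hab : rho₂ p * gammaPerm p 2 = gammaPerm p 2 * rho₂ p * rho₁ p :=
    Equiv.ext fun ⟨i, j⟩ => by
      simp only [Equiv.Perm.mul_apply, hγ, rho₁_apply, rho₂_apply]
      ext <;> simp
  obtain ⟨φ, hφ⟩ := exists_heisenberg_hom (p := p) rho₂_pow_prime hγp rho₁_pow_prime hca hcb hab
  have hφ' : ∀ l m n : ℕ, φ (heisMk l m n) = gammaPerm p 2 ^ m * rho₂ p ^ l * rho₁ p ^ n :=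
    fun l m n => by rw [hφ, zmodPow_natCast, zmodPow_natCast, zmodPow_natCast]
  have hinj : Function.Injective φ := by
    rw [injective_iff_map_eq_one]
    intro A h
    obtain ⟨x, y, z, rfl⟩ := heisMk_surjective A
    obtain ⟨l, rfl⟩ := ZMod.natCast_zmod_surjective x
    obtain ⟨m, rfl⟩ := ZMod.natCast_zmod_surjective y
    obtain ⟨n, rfl⟩ := ZMod.natCast_zmod_surjective z
    rw [hφ'] at h
    have h1 : ∀ i j : ZMod p, (i + l, j + n - m * (i + l + 1)) = (i, j) := fun i j => by
      have := Equiv.congr_fun h (i, j)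
      rwa [Equiv.Perm.mul_apply, Equiv.Perm.mul_apply, rho₁_pow_apply, rho₂_pow_apply,
        gammaPerm_two_pow_apply hp2, Equiv.Perm.one_apply] at this
    have hl : (l : ZMod p) = 0 := by simpa using congrArg Prod.fst (h1 0 0)
    -- At `i = -1` the contribution of `γ_2` disappears, which isolates `n`.
    have hn : (n : ZMod p) = 0 := by simpa [hl] using congrArg Prod.snd (h1 (-1) 0)
    have hm : (m : ZMod p) = 0 := by simpa [hl, hn] using congrArg Prod.snd (h1 0 0)
    rw [hl, hm, hn, heisMk_zero]
  have hrange : φ.range = PPrime p 2 := by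
    apply le_antisymm
    · rintro _ ⟨A, rfl⟩
      obtain ⟨x, y, z, rfl⟩ := heisMk_surjective A
      rw [hφ]
      exact mul_mem (mul_mem (zmodPow_mem _ _ (Subgroup.subset_closure (by simp)))
        (zmodPow_mem _ _ (Subgroup.subset_closure (by simp))))
        (zmodPow_mem _ _ (Subgroup.subset_closure (by simp)))
    · rw [PPrime, Subgroup.closure_le]
      rintro _ (rfl | rfl | rfl)
      · exact ⟨heisMk (0 : ℕ) (0 : ℕ) (1 : ℕ), by rw [hφ']; simp⟩
      · exact ⟨heisMk (1 : ℕ) (0 : ℕ) (0 : ℕ), by rw [hφ']; simp⟩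
      · exact ⟨heisMk (0 : ℕ) (1 : ℕ) (0 : ℕ), by rw [hφ']; simp⟩
  exact ⟨((MonoidHom.ofInjective hinj).trans (MulEquiv.subgroupCongr hrange)).symm⟩

end PPrime

/-! ### Heisenberg coordinates on transitive groups of degree `p²` -/

section Chart

theorem mem_of_zmodPow_mem {p : ℕ} [hp : Fact p.Prime] {Γ : Type*} [Group Γ] {a : Γ}
    (ha : a ^ p = 1) {x : ZMod p} (hx : x ≠ 0) {S : Subgroup Γ}
    (h : zmodPow ha (Multiplicative.ofAdd x) ∈ S) : a ∈ S := by
  have h1 : zmodPow ha (Multiplicative.ofAdd x) ^ x⁻¹.val = a := by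
    rw [← map_pow, ← ofAdd_nsmul, nsmul_eq_mul, ZMod.natCast_zmod_val, inv_mul_cancel₀ hx,
      zmodPow_one]
  exact h1 ▸ pow_mem h _

theorem exists_injective_cpSq_hom {p : ℕ} [hp : Fact p.Prime] {Γ : Type*} [Group Γ] {a b : Γ}
    (ha : a ^ p = 1) (hb : b ^ p = 1) (hab : Commute a b) (hb1 : b ≠ 1) {S : Subgroup Γ}
    (hbS : b ∈ S) (haS : a ∉ S) :
    ∃ φ : Multiplicative (ZMod p) × Multiplicative (ZMod p) →* Γ, Function.Injective φ ∧
      ∀ x y, φ (x, y) = zmodPow ha x * zmodPow hb y := by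
  obtain ⟨φ, hφ⟩ := exists_cpSq_hom ha hb hab
  refine ⟨φ, ?_, hφ⟩
  rw [injective_iff_map_eq_one]
  rintro ⟨x, y⟩ h
  rw [hφ] at h
  have hx : x.toAdd = 0 := by
    by_contra hx
    refine haS (mem_of_zmodPow_mem ha hx ?_)
    rw [ofAdd_toAdd, eq_inv_of_mul_eq_one_left h]
    exact inv_mem (zmodPow_mem hb y hbS)
  have hx1 : x = 1 := hx
  rw [hx1, map_one, one_mul] at h
  have hy := (zmodPow_eq_one_iff hb hb1 y.toAdd).1 h
  exact Prod.ext hx1 hy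

/-- Coordinates of Heisenberg type on a group acting on `X`, adapted to the stabilizer
of `x₀`. -/
structure HeisChart (p : ℕ) (G : Type) [Group G] {X : Type} [MulAction G X] (x₀ : X) where
  /-- the coordinate `x` -/
  x : G → ZMod p
  /-- the coordinate `y` -/
  y : G → ZMod p
  /-- the central coordinate -/
  α : G → ZMod p
  x_mul : ∀ g h, x (g * h) = x g + x h
  y_mul : ∀ g h, y (g * h) = y g + y h
  α_mul : ∀ g h, α (g * h) = α g + α h + x g * y h
  ext : ∀ g h, x g = x h → y g = y h → α g = α h → g = h
  smul_eq_iff : ∀ g : G, g • x₀ = x₀ ↔ x g = 0 ∧ α g = 0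
  /-- an element outside the block kernel -/
  t : G
  x_t : x t = 1
  /-- a central element -/
  z : G
  x_z : x z = 0
  y_z : y z = 0
  α_z : α z = 1
  y_t : y t = 0
  α_t : α t = 0

variable {p : ℕ} [hp : Fact p.Prime] {G : Type} [Group G] [Finite G] {X : Type} [MulAction G X]
  [FaithfulSMul G X] [MulAction.IsPretransitive G X] {N : Subgroup G}

theorem exists_chart_of_card_stabilizer_eq_one (hX : Nat.card X = p ^ 2) (hG : IsPGroup p G)
    (hexp : ∀ g : G, g ^ p = 1) (x₀ : X) (hcard : Nat.card (MulAction.stabilizer G x₀) = 1) :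
    Nonempty (G ≃* Multiplicative (ZMod p) × Multiplicative (ZMod p)) ∧
      Nonempty (HeisChart p G x₀) := by
  obtain ⟨N, hN⟩ := exists_isBlockKernel hX hG x₀
  obtain ⟨t, ht⟩ := hN.exists_notMem
  obtain ⟨z, hz, hz1, hzc⟩ := hN.exists_central hG x₀
  obtain ⟨φ, hinj, hφ⟩ := exists_injective_cpSq_hom (hexp t) (hexp z) (hzc t).symm hz1 hz ht
  have hcG : Nat.card G = p ^ 2 := by
    rw [card_eq_mul_card_stabilizer hX x₀, hcard, mul_one]
  have hbij : Function.Bijective φ :=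
    hinj.bijective_of_nat_card_le (by rw [hcG, card_cpSq])
  let e := MulEquiv.ofBijective φ hbij
  have het : e.symm t = (Multiplicative.ofAdd 1, 1) := by
    rw [MulEquiv.symm_apply_eq]
    change t = φ _
    rw [hφ, zmodPow_one, map_one, mul_one]
  have hez : e.symm z = (1, Multiplicative.ofAdd 1) := by
    rw [MulEquiv.symm_apply_eq]
    change z = φ _
    rw [hφ, zmodPow_one, map_one, one_mul]
  refine ⟨⟨e.symm⟩, ⟨
    { x := fun g => (e.symm g).1.toAdd
      -- With `y = 0` the twisted addition law of `α` becomes additive, so `(C_p)²` is covered by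
      -- the same coordinates.
      y := fun _ => 0
      α := fun g => (e.symm g).2.toAdd
      x_mul := fun g h => by simp
      y_mul := fun g h => by simp
      α_mul := fun g h => by simp
      ext := fun g h h1 _ h2 => e.symm.injective (Prod.ext h1 h2)
      smul_eq_iff := fun g => ?_
      t := t
      x_t := by simp [het]
      z := z
      x_z := by simp [hez]
      y_z := rfl
      α_z := by simp [hez]
      y_t := rfl
      α_t := by simp [het] }⟩⟩
  have hbot : MulAction.stabilizer G x₀ = ⊥ := Subgroup.eq_bot_of_card_eq _ hcard
  rw [← MulAction.mem_stabilizer_iff, hbot, Subgroup.mem_bot]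
  constructor
  · rintro rfl
    simp
  · rintro ⟨h1, h2⟩
    apply e.symm.injective
    rw [map_one]
    exact Prod.ext h1 h2

/-- A generator `b` of the stabilizer fixes a point, so it is not central and its commutator `c`
with `t` is nontrivial. This `c` is central because `G / ⟨z⟩` has order `p²` and is abelian. Thus
`t, b, c` satisfy the Heisenberg relations, and orders agree. -/
theorem exists_chart_of_card_stabilizer_eq_prime (hX : Nat.card X = p ^ 2) (hG : IsPGroup p G)
    (hexp : ∀ g : G, g ^ p = 1) (x₀ : X) (hcard : Nat.card (MulAction.stabilizer G x₀) = p) :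
    Nonempty (G ≃* heisenberg p) ∧ Nonempty (HeisChart p G x₀) := by
  obtain ⟨N, hN⟩ := exists_isBlockKernel hX hG x₀
  obtain ⟨t, ht⟩ := hN.exists_notMem
  obtain ⟨z, hz, hz1, hzc⟩ := hN.exists_central hG x₀
  have hcG : Nat.card G = p ^ 3 := by
    rw [card_eq_mul_card_stabilizer hX x₀, hcard]
    ring
  obtain ⟨⟨b, hb⟩, hb1⟩ : ∃ b : MulAction.stabilizer G x₀, b ≠ 1 := by
    have : Nontrivial (MulAction.stabilizer G x₀) :=
      Finite.one_lt_card_iff_nontrivial.1 (by rw [hcard]; exact hp.out.one_lt)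
    exact exists_ne 1
  have hb1 : b ≠ 1 := fun h => hb1 (Subtype.ext h)
  have hbN := hN.stabilizer_le x₀ hb
  have : (Subgroup.zpowers z).Normal := ⟨by
    rintro n hn g
    obtain ⟨k, rfl⟩ := Subgroup.mem_zpowers_iff.1 hn
    rw [← ((hzc g).zpow_left k).eq, mul_inv_cancel_right]
    exact hn⟩
  have hcq : Nat.card (G ⧸ Subgroup.zpowers z) = p ^ 2 := by
    have h1 := (Subgroup.zpowers z).card_mul_index
    rw [Nat.card_zpowers, orderOf_eq_prime (hexp z) hz1, hcG] at h1
    have h2 : p * (Subgroup.zpowers z).index = p * p ^ 2 := by rw [h1]; ring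
    exact Nat.eq_of_mul_eq_mul_left hp.out.pos h2
  let c := t⁻¹ * b⁻¹ * t * b
  have hcz : c ∈ Subgroup.zpowers z := by
    have := IsPGroup.isMulCommutative_of_card_eq_prime_sq hcq
    rw [← QuotientGroup.eq_one_iff]
    simp only [c, QuotientGroup.mk_mul, QuotientGroup.mk_inv]
    rw [mul_comm' (t : G ⧸ Subgroup.zpowers z)⁻¹]
    group
  have hcc : ∀ g, Commute c g := by
    intro g
    obtain ⟨k, hk⟩ := Subgroup.mem_zpowers_iff.1 hcz
    rw [← hk]
    exact (hzc g).zpow_left k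
  have htb : t * b = b * t * c := by simp only [c]; group
  have hc1 : c ≠ 1 := by
    intro h
    rw [h, mul_one] at htb
    refine hb1 (eq_one_of_central_of_smul_eq (fun g => ?_) hb)
    obtain ⟨k, n, hn, rfl⟩ := hN.exists_zpow_mul_mem ht g
    exact ((show Commute b t from htb.symm).zpow_right k).mul_right (hN.commute hG hbN hn)
  obtain ⟨φ, hφ⟩ := exists_heisenberg_hom (hexp t) (hexp b) (hexp c) (hcc t) (hcc b) htb
  have hcN : c ∈ N := by
    obtain ⟨k, hk⟩ := Subgroup.mem_zpowers_iff.1 hcz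
    exact hk ▸ zpow_mem hz k
  have hstab : ∀ x y w, φ (heisMk x y w) • x₀ = x₀ ↔ x = 0 ∧ w = 0 := by
    intro x y w
    constructor
    · intro h
      rw [hφ] at h
      have hbm := zmodPow_mem (hexp b) (Multiplicative.ofAdd y) hb
      have hx : x = 0 := by
        by_contra hx
        refine ht (mem_of_zmodPow_mem (hexp t) hx ?_)
        have h1 := hN.stabilizer_le x₀ (MulAction.mem_stabilizer_iff.2 h)
        have h2 := zmodPow_mem (hexp b) (Multiplicative.ofAdd y) hbN
        have h3 := zmodPow_mem (hexp c) (Multiplicative.ofAdd w) hcN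
        exact (N.mul_mem_cancel_left h2).1 ((N.mul_mem_cancel_right h3).1 h1)
      refine ⟨hx, ?_⟩
      rw [hx, ofAdd_zero, map_one, mul_one] at h
      have h1 := (Subgroup.mul_mem_cancel_left _ hbm).1 (MulAction.mem_stabilizer_iff.2 h)
      by_contra hw
      exact hc1 (eq_one_of_central_of_smul_eq hcc (mem_of_zmodPow_mem (hexp c) hw h1))
    · rintro ⟨rfl, rfl⟩
      rw [hφ, ofAdd_zero, map_one, map_one, mul_one, mul_one]
      exact zmodPow_mem (hexp b) _ hb
  have hinj : Function.Injective φ := by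
    rw [injective_iff_map_eq_one]
    intro A h
    obtain ⟨x, y, w, rfl⟩ := heisMk_surjective A
    obtain ⟨rfl, rfl⟩ := (hstab x y w).1 (by rw [h, one_smul])
    rw [hφ, ofAdd_zero, map_one, map_one, mul_one, mul_one, zmodPow_eq_one_iff _ hb1] at h
    rw [h, heisMk_zero]
  have hbij : Function.Bijective φ :=
    hinj.bijective_of_nat_card_le (by rw [hcG, card_heisenberg])
  let e := MulEquiv.ofBijective φ hbij
  have het : e.symm t = heisMk 1 0 0 := by
    rw [MulEquiv.symm_apply_eq]
    change t = φ _
    rw [hφ, zmodPow_one, ofAdd_zero, map_one, map_one, mul_one, one_mul]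
  have hec : e.symm c = heisMk 0 0 1 := by
    rw [MulEquiv.symm_apply_eq]
    change c = φ _
    rw [hφ, zmodPow_one, ofAdd_zero, map_one, map_one, one_mul, one_mul]
  have hmul : ∀ A B : heisenberg p, heisX (A * B) = heisX A + heisX B ∧
      heisY (A * B) = heisY A + heisY B ∧
      heisZ (A * B) = heisZ A + heisZ B + heisX A * heisY B := by
    intro A B
    obtain ⟨x, y, w, rfl⟩ := heisMk_surjective A
    obtain ⟨x', y', w', rfl⟩ := heisMk_surjective B
    rw [heisMk_mul]
    simp
  exact ⟨⟨e.symm⟩, ⟨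
    { x := fun g => heisX (e.symm g)
      y := fun g => heisY (e.symm g)
      α := fun g => heisZ (e.symm g)
      x_mul := fun g h => by rw [map_mul, (hmul _ _).1]
      y_mul := fun g h => by rw [map_mul, (hmul _ _).2.1]
      α_mul := fun g h => by rw [map_mul, (hmul _ _).2.2]
      ext := fun g h h1 h2 h3 => e.symm.injective (by
        rw [← heisMk_coords (e.symm g), ← heisMk_coords (e.symm h), h1, h2, h3])
      smul_eq_iff := fun g => by
        have h1 : g = φ (e.symm g) := (e.apply_symm_apply g).symm
        conv_lhs => rw [h1, ← heisMk_coords (e.symm g), hstab]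
      t := t
      x_t := by rw [het, heisX_mk]
      z := c
      x_z := by rw [hec, heisX_mk]
      y_z := by rw [hec, heisY_mk]
      α_z := by rw [hec, heisZ_mk]
      y_t := by rw [het, heisY_mk]
      α_t := by rw [het, heisZ_mk] }⟩⟩

theorem exists_chart (hX : Nat.card X = p ^ 2) (hG : IsPGroup p G)
    (hexp : ∀ g : G, g ^ p = 1) (x₀ : X) (hcard : Nat.card (MulAction.stabilizer G x₀) ≤ p) :
    (Nonempty (G ≃* Multiplicative (ZMod p) × Multiplicative (ZMod p)) ∨
      Nonempty (G ≃* heisenberg p)) ∧ Nonempty (HeisChart p G x₀) := by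
  obtain ⟨k, hk⟩ := IsPGroup.iff_card.1 (hG.to_subgroup (MulAction.stabilizer G x₀))
  rw [hk] at hcard
  have hk1 : k ≤ 1 := (Nat.pow_le_pow_iff_right hp.out.one_lt).1 (by rwa [pow_one])
  interval_cases k
  · obtain ⟨h1, h2⟩ := exists_chart_of_card_stabilizer_eq_one hX hG hexp x₀ (by rw [hk, pow_zero])
    exact ⟨Or.inl h1, h2⟩
  · obtain ⟨h1, h2⟩ := exists_chart_of_card_stabilizer_eq_prime hX hG hexp x₀ (by rw [hk, pow_one])
    exact ⟨Or.inr h1, h2⟩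

end Chart

theorem heisMk_pow {p : ℕ} (x y z : ZMod p) (n : ℕ) :
    heisMk x y z ^ n = heisMk ((n : ZMod p) * x) ((n : ZMod p) * y)
      ((n : ZMod p) * z + (n.choose 2 : ZMod p) * (x * y)) := by
  induction n with
  | zero => simp [heisMk_zero]
  | succ n ih =>
    rw [pow_succ, ih, heisMk_mul, Nat.choose_succ_succ]
    congr 1 <;> simp <;> ring

/-- For `p > 2` the binomial coefficient `p.choose 2` in the central coordinate is divisible by `p`.
-/
theorem heisenberg_pow_prime {p : ℕ} (hp : p.Prime) (hp2 : 2 < p) (A : heisenberg p) :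
    A ^ p = 1 := by
  obtain ⟨x, y, z, rfl⟩ := heisMk_surjective A
  rw [heisMk_pow, (ZMod.natCast_eq_zero_iff _ _).2 (hp.dvd_choose_self two_ne_zero hp2)]
  simp [heisMk_zero]

theorem cpSq_pow_prime {p : ℕ} (A : Multiplicative (ZMod p) × Multiplicative (ZMod p)) :
    A ^ p = 1 := by
  have h : ∀ x : Multiplicative (ZMod p), x ^ p = 1 := fun x => by
    apply Multiplicative.toAdd.injective
    simp
  exact Prod.ext (h _) (h _)

/-! ### The group `Ш²` for `P'_1` and `P'_2` -/

section InvP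

variable {p : ℕ}

theorem nsmul_inv_natCast [hp : Fact p.Prime] :
    p • ((1 / p : ℚ) : AddCircle (1 : ℚ)) = 0 := by
  have hp0 : (p : ℚ) ≠ 0 := by exact_mod_cast hp.out.ne_zero
  rw [← AddCircle.coe_nsmul, nsmul_eq_mul, mul_one_div_cancel hp0]
  exact_mod_cast coe_int_addCircle 1

/-- The embedding of `ℤ/p` in `ℚ/ℤ` sending `1` to `1/p`. -/
def zmodToCircle (p : ℕ) [hp : Fact p.Prime] : ZMod p →+ AddCircle (1 : ℚ) :=
  ZMod.lift p ⟨zmultiplesHom _ ((1 / p : ℚ) : AddCircle (1 : ℚ)), by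
    rw [zmultiplesHom_apply, natCast_zsmul, nsmul_inv_natCast]⟩

theorem zmodToCircle_one [hp : Fact p.Prime] :
    zmodToCircle p 1 = ((1 / p : ℚ) : AddCircle (1 : ℚ)) := by
  have h := ZMod.lift_coe p (⟨zmultiplesHom _ ((1 / p : ℚ) : AddCircle (1 : ℚ)), by
    rw [zmultiplesHom_apply, natCast_zsmul, nsmul_inv_natCast]⟩ :
      {f : ℤ →+ AddCircle (1 : ℚ) // f p = 0}) 1
  rw [Int.cast_one] at h
  refine h.trans ?_
  simp

theorem zmodToCircle_one_ne_zero [hp : Fact p.Prime] : zmodToCircle p 1 ≠ 0 := by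
  have hp0 : (p : ℚ) ≠ 0 := by exact_mod_cast hp.out.ne_zero
  rw [zmodToCircle_one]
  intro h
  obtain ⟨n, hn⟩ := (AddCircle.coe_eq_zero_iff _).1 h
  rw [zsmul_eq_mul, mul_one, eq_div_iff hp0] at hn
  have h1 : n * p = 1 := by exact_mod_cast hn
  have h2 : (p : ℤ) ∣ 1 := ⟨n, by rw [← h1, mul_comm]⟩
  exact hp.out.one_lt.ne' (by exact_mod_cast Int.eq_one_of_dvd_one (by positivity) h2)

theorem exists_nsmul_of_nsmul_eq_zero [hp : Fact p.Prime] {a : AddCircle (1 : ℚ)}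
    (ha : p • a = 0) : ∃ k : ℕ, a = k • zmodToCircle p 1 := by
  have hp0 : (p : ℚ) ≠ 0 := by exact_mod_cast hp.out.ne_zero
  obtain ⟨q, rfl⟩ := QuotientAddGroup.mk_surjective a
  obtain ⟨n, hn⟩ := (AddCircle.coe_eq_zero_iff (1 : ℚ)).1
    (show ((p • q : ℚ) : AddCircle (1 : ℚ)) = 0 from ha)
  rw [zsmul_eq_mul, mul_one, nsmul_eq_mul] at hn
  obtain ⟨k, hk⟩ := ZMod.natCast_zmod_surjective (n : ZMod p)
  refine ⟨k, ?_⟩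
  have h1 : (p : ℤ) ∣ k - n := by
    rw [← ZMod.intCast_zmod_eq_zero_iff_dvd]
    push_cast
    rw [hk, sub_self]
  obtain ⟨m, hm⟩ := h1
  have h2 : q = k • (1 / p : ℚ) - m := by
    have h3 : (k : ℚ) - n = p * m := by exact_mod_cast hm
    rw [nsmul_eq_mul]
    field_simp
    linarith
  rw [zmodToCircle_one, ← AddCircle.coe_nsmul]
  change ((q : ℚ) : AddCircle (1 : ℚ)) = _
  rw [h2, AddCircle.coe_sub, coe_int_addCircle, sub_zero]

end InvP

/-- A nontrivial `D` has a central `ζ ≠ 1`. In exponent `p`, an element of `D` outside `⟨ζ⟩` would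
generate a copy of `(C_p)²` together with `ζ`. -/
theorem exists_eq_zpowers_of_not_containsCpSq {p : ℕ} [hp : Fact p.Prime] {G : Type} [Group G] [Finite G]
    (hG : IsPGroup p G) (hexp : ∀ g : G, g ^ p = 1) (D : Subgroup G) (hD : ¬ ContainsCpSq p D) :
    ∃ g, D = Subgroup.zpowers g := by
  by_cases hbot : D = ⊥
  · exact ⟨1, by rw [hbot, Subgroup.zpowers_one_eq_bot]⟩
  have : Nontrivial D := D.nontrivial_iff_ne_bot.2 hbot
  have := (hG.to_subgroup D).center_nontrivial
  obtain ⟨⟨⟨ζ, hζD⟩, hζ⟩, hζ1⟩ := exists_ne (1 : Subgroup.center D)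
  have hζ1 : ζ ≠ 1 := fun h => hζ1 (Subtype.ext (Subtype.ext h))
  refine ⟨ζ, le_antisymm (fun d hd => ?_) (by rwa [Subgroup.zpowers_le])⟩
  by_contra hdζ
  refine hD ?_
  have hcomm : Commute d ζ := congrArg Subtype.val (Subgroup.mem_center_iff.1 hζ ⟨d, hd⟩)
  obtain ⟨φ, hinj, hφ⟩ := exists_injective_cpSq_hom (hexp d) (hexp ζ) hcomm hζ1
    (Subgroup.mem_zpowers ζ) hdζ
  refine ⟨φ.range, ?_, ⟨(MonoidHom.ofInjective hinj).symm⟩⟩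
  rintro _ ⟨⟨x, y⟩, rfl⟩
  rw [hφ]
  exact mul_mem (zmodPow_mem _ _ hd) (zmodPow_mem _ _ hζD)

/-- The commutator of the lifts of `t` and `z` is the scalar `a`. -/
def HasLiftCommutator {G X : Type} [Group G] [MulAction G X] (c : G → X → AddCircle (1 : ℚ))
    (t z : G) (a : AddCircle (1 : ℚ)) : Prop :=
  ∀ y, c t y + c z (t⁻¹ • y) = c z y + c t (z⁻¹ • y) + a

/-! ### The commutator of two lifts as an additive invariant of the class. -/

section LiftCommutator

variable {G X : Type} [Group G] [MulAction G X] {c d : G → X → AddCircle (1 : ℚ)} {t z : G}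
  {a b : AddCircle (1 : ℚ)}

theorem HasLiftCommutator.add (h : HasLiftCommutator c t z a) (h' : HasLiftCommutator d t z b) :
    HasLiftCommutator (c + d) t z (a + b) := by
  intro y
  have h1 := congrArg₂ (· + ·) (h y) (h' y)
  simp only [Pi.add_apply] at h1 ⊢
  calc _ = c t y + c z (t⁻¹ • y) + (d t y + d z (t⁻¹ • y)) := by abel
    _ = _ := h1
    _ = _ := by abel

theorem HasLiftCommutator.nsmul (h : HasLiftCommutator c t z a) (n : ℕ) :
    HasLiftCommutator (n • c) t z (n • a) := by
  induction n with
  | zero => intro y; simp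
  | succ n ih => simpa only [succ_nsmul] using ih.add h

theorem hasLiftCommutator_zero_iff (htz : Commute z t) :
    HasLiftCommutator c t z 0 ↔ Commute (⟨c z, z⟩ : Monomial G X) ⟨c t, t⟩ := by
  constructor
  · intro h
    refine Monomial.ext (funext fun y => ?_) htz
    simpa using (h y).symm
  · intro h y
    have := congrArg (fun w : Monomial G X => w.left y) h.eq
    simpa using this.symm

/-- The `p`-th power of the lift of `z` is a scalar, so conjugating it by the lift of `t` changes
nothing, yet it multiplies it by the `p`-th power of the commutator. -/
theorem exists_hasLiftCommutator (hc : IsProjCocycle c) (htz : Commute z t) {p : ℕ}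
    [Nonempty X] (hz : z ^ p = 1) : ∃ a, p • a = 0 ∧ HasLiftCommutator c t z a := by
  let T : Monomial G X := ⟨c t, t⟩
  let Z : Monomial G X := ⟨c z, z⟩
  have hT : T ∈ extGroup c hc := lift_mem t
  have hZ : Z ∈ extGroup c hc := lift_mem z
  have hr : (T * Z).right = (Z * T).right := htz.eq.symm
  obtain ⟨a, ha⟩ := exists_eq_scalar_mul (mul_mem hT hZ) (mul_mem hZ hT) hr
  obtain ⟨b, hb⟩ := exists_eq_scalar_mul (pow_mem hZ p) (one_mem _)
    (by rw [pow_right, one_right, hz])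
  refine ⟨a.toAdd, ?_, fun y => ?_⟩
  · have h1 : T * Z * T⁻¹ = scalar a * Z := by rw [ha]; group
    have h2 : scalar (a ^ p) * Z ^ p = Z ^ p := by
      rw [map_pow, ← (scalar_commute a Z).mul_pow, ← h1, conj_pow, hb, mul_one,
        ← (scalar_commute b T).eq, mul_inv_cancel_right]
    have h3 : (scalar (a ^ p) : Monomial G X) = 1 := mul_eq_right.1 h2
    obtain ⟨y⟩ := ‹Nonempty X›
    exact congrArg (fun w : Monomial G X => w.left y) h3
  · have := congrArg (fun w : Monomial G X => w.left y) ha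
    simp only [mul_left_apply, scalar_left_apply, scalar_right, inv_one, one_smul] at this
    rw [add_comm (_ + _) a.toAdd]
    exact this

end LiftCommutator

theorem constOnFixed_of_isAdmissible {G X : Type} [Group G] [MulAction G X]
    {c : G → X → AddCircle (1 : ℚ)} {𝒟 : Set (Subgroup G)}
    (h𝒟 : IsAdmissible 𝒟) (h : ∀ D ∈ 𝒟, TrivialOn D c) : ConstOnFixed c :=
  constOnFixed_of_trivialOn_zpowers fun g => h _ (h𝒟.1 (by
    change IsCyclic _
    infer_instance))

/-! ### Computation of `Ш²` in Heisenberg coordinates. -/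

namespace HeisChart

variable {p : ℕ} [hp : Fact p.Prime] {G : Type} [Group G] {X : Type} [MulAction G X]
  {x₀ : X} (C : HeisChart p G x₀)

theorem x_one : C.x 1 = 0 := by simpa using C.x_mul 1 1
theorem y_one : C.y 1 = 0 := by simpa using C.y_mul 1 1
theorem α_one : C.α 1 = 0 := by simpa [C.x_one] using C.α_mul 1 1

theorem x_inv (g : G) : C.x g⁻¹ = -C.x g := by
  rw [eq_neg_iff_add_eq_zero, ← C.x_mul, inv_mul_cancel, C.x_one]

theorem y_inv (g : G) : C.y g⁻¹ = -C.y g := by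
  rw [eq_neg_iff_add_eq_zero, ← C.y_mul, inv_mul_cancel, C.y_one]

theorem commute_z (g : G) : Commute C.z g :=
  C.ext _ _ (by rw [C.x_mul, C.x_mul, add_comm]) (by rw [C.y_mul, C.y_mul, add_comm])
    (by rw [C.α_mul, C.α_mul, C.x_z, C.y_z]; ring)

/-- Passing from `h` to `g⁻¹ h g` subtracts `x g * y h` from the central coordinate and keeps the
other two. -/
theorem conj_smul_iff {h : G} (hx : C.x h = 0) (g : G) :
    h • g • x₀ = g • x₀ ↔ C.α h = C.x g * C.y h := by
  have h1 : h • g • x₀ = g • x₀ ↔ (g⁻¹ * (h * g)) • x₀ = x₀ := by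
    rw [mul_smul, mul_smul, inv_smul_eq_iff]
  rw [h1, C.smul_eq_iff]
  have h2 : C.x (g⁻¹ * (h * g)) = 0 := by rw [C.x_mul, C.x_mul, C.x_inv, hx]; ring
  have h3 : C.y (g⁻¹ * (h * g)) = C.y h := by rw [C.y_mul, C.y_mul, C.y_inv]; ring
  have h4 := C.α_mul g (g⁻¹ * (h * g))
  rw [mul_inv_cancel_left, C.α_mul, hx, h3] at h4
  have h5 : C.α h = C.α (g⁻¹ * (h * g)) + C.x g * C.y h := by linear_combination h4
  rw [h5]
  simp [h2]

/-- The kernel of the coordinate `x`. -/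
def kernel : Subgroup G where
  carrier := {g | C.x g = 0}
  mul_mem' {a b} ha hb := by
    change C.x (a * b) = 0
    rw [C.x_mul, show C.x a = 0 from ha, show C.x b = 0 from hb, add_zero]
  one_mem' := C.x_one
  inv_mem' {a} ha := by
    change C.x a⁻¹ = 0
    rw [C.x_inv, show C.x a = 0 from ha, neg_zero]

theorem mem_kernel {g : G} : g ∈ C.kernel ↔ C.x g = 0 := Iff.rfl

theorem x_pow (g : G) (n : ℕ) : C.x (g ^ n) = n * C.x g := by
  induction n with
  | zero => simp [C.x_one]
  | succ n ih => rw [pow_succ, C.x_mul, ih]; push_cast; ring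

theorem y_pow (g : G) (n : ℕ) : C.y (g ^ n) = n * C.y g := by
  induction n with
  | zero => simp [C.y_one]
  | succ n ih => rw [pow_succ, C.y_mul, ih]; push_cast; ring

theorem α_pow {g : G} (hx : C.x g = 0) (n : ℕ) : C.α (g ^ n) = n * C.α g := by
  induction n with
  | zero => simp [C.α_one]
  | succ n ih => rw [pow_succ, C.α_mul, ih, C.x_pow, hx]; push_cast; ring

theorem isBlockKernel [Finite G] [MulAction.IsPretransitive G X] (hX : Nat.card X = p ^ 2) :
    IsBlockKernel p X C.kernel := by
  refine isBlockKernel_of_stabilizer_le hX _ ⟨fun n hn g => ?_⟩ ?_ x₀ fun h hh =>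
    ((C.smul_eq_iff h).1 hh).1
  · rw [C.mem_kernel] at hn ⊢
    rw [C.x_mul, C.x_mul, C.x_inv, hn]
    ring
  · let f : G →* Multiplicative (ZMod p) :=
      MonoidHom.mk' (fun g => Multiplicative.ofAdd (C.x g)) fun g h => by
        rw [C.x_mul, ofAdd_add]
    have hker : C.kernel = f.ker := by
      ext g
      rfl
    have hsurj : Function.Surjective f := by
      intro m
      obtain ⟨n, hn⟩ := ZMod.natCast_zmod_surjective m.toAdd
      refine ⟨C.t ^ n, ?_⟩
      change Multiplicative.ofAdd (C.x (C.t ^ n)) = m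
      rw [C.x_pow, C.x_t, mul_one, hn]
      rfl
    rw [hker, Subgroup.index_ker, MonoidHom.range_eq_top.2 hsurj, Subgroup.card_top,
      Nat.card_congr Multiplicative.toAdd, Nat.card_zmod]

theorem t_notMem_kernel : C.t ∉ C.kernel := by
  rw [C.mem_kernel, C.x_t]
  exact one_ne_zero

theorem z_mem_kernel : C.z ∈ C.kernel := C.x_z

theorem z_ne_one : C.z ≠ 1 := by
  intro h
  have := C.α_z
  rw [h, C.α_one] at this
  exact zero_ne_one this

theorem trivialOn_top [Finite G] [MulAction.IsPretransitive G X] [FaithfulSMul G X]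
    (hX : Nat.card X = p ^ 2) (hG : IsPGroup p G) {c : G → X → AddCircle (1 : ℚ)}
    (hc : IsProjCocycle c) (hS : ConstOnFixed c) {t : G} (ht : t ∉ C.kernel)
    (h : Commute (⟨c C.z, C.z⟩ : Monomial G X) ⟨c t, t⟩) : TrivialOn ⊤ c :=
  (C.isBlockKernel hX).trivialOn_top hG x₀ hc hS C.z_mem_kernel C.z_ne_one C.commute_z ht h

/-- A subgroup `K` isomorphic to `(C_p)²` contains `z`. If `K` has an element outside the kernel of
`x`, its lift commutes with that of `z` by triviality on `K`. Otherwise `K` is the whole kernel, and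
`z` is a product of two elements of `K` with fixed points. -/
theorem trivialOn_top_of_containsCpSq (C : HeisChart p G x₀) [Finite G]
    [MulAction.IsPretransitive G X]
    [FaithfulSMul G X] (hX : Nat.card X = p ^ 2) (hG : IsPGroup p G)
    {c : G → X → AddCircle (1 : ℚ)} (hc : IsProjCocycle c) (hS : ConstOnFixed c)
    {D : Subgroup G} (hD : ContainsCpSq p D) (hDc : TrivialOn D c) : TrivialOn ⊤ c := by
  obtain ⟨K, hKD, ⟨e⟩⟩ := hD
  have hKc := hDc.mono hKD
  have hKcard : Nat.card K = Nat.card (ZMod p × ZMod p) := by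
    rw [Nat.card_congr e.toEquiv, card_cpSq, Nat.card_prod, Nat.card_zmod, pow_two]
  have hKcomm : ∀ a ∈ K, ∀ b ∈ K, a * b = b * a := fun a ha b hb =>
    congrArg Subtype.val (e.injective (by rw [map_mul, map_mul, mul_comm]) :
      (⟨a, ha⟩ : K) * ⟨b, hb⟩ = ⟨b, hb⟩ * ⟨a, ha⟩)
  -- Otherwise `(x, y)` would map `K` bijectively onto `𝔽_p²`, and the elements over `(1, 0)` and
  -- `(0, 1)` would not commute.
  have hzK : C.z ∈ K := by
    by_contra hzK
    have hker : ∀ k ∈ K, C.x k = 0 → C.y k = 0 → C.α k = 0 := by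
      intro k hk hx hy
      by_contra hα
      refine hzK ?_
      have : C.z = k ^ (C.α k)⁻¹.val := by
        refine C.ext _ _ ?_ ?_ ?_
        · rw [C.x_z, C.x_pow, hx, mul_zero]
        · rw [C.y_z, C.y_pow, hy, mul_zero]
        · rw [C.α_z, C.α_pow hx, ZMod.natCast_zmod_val, inv_mul_cancel₀ hα]
      rw [this]
      exact pow_mem hk _
    let f : K → ZMod p × ZMod p := fun k => (C.x k, C.y k)
    have hf : Function.Injective f := by
      rintro ⟨k, hk⟩ ⟨k', hk'⟩ hkk
      have h1 : C.x k = C.x k' := congrArg Prod.fst hkk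
      have h2 : C.y k = C.y k' := congrArg Prod.snd hkk
      have h3 : k⁻¹ * k' = 1 := by
        have hx : C.x (k⁻¹ * k') = 0 := by rw [C.x_mul, C.x_inv, h1]; ring
        have hy : C.y (k⁻¹ * k') = 0 := by rw [C.y_mul, C.y_inv, h2]; ring
        exact C.ext _ _ (hx.trans C.x_one.symm) (hy.trans C.y_one.symm)
          ((hker _ (mul_mem (inv_mem hk) hk') hx hy).trans C.α_one.symm)
      exact Subtype.ext (inv_mul_eq_one.1 h3)
    have hsurj := (hf.bijective_of_nat_card_le hKcard.ge).2
    obtain ⟨⟨a, ha⟩, haf⟩ := hsurj (1, 0)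
    obtain ⟨⟨b, hb⟩, hbf⟩ := hsurj (0, 1)
    have hax : C.x a = 1 := congrArg Prod.fst haf
    have hay : C.y a = 0 := congrArg Prod.snd haf
    have hbx : C.x b = 0 := congrArg Prod.fst hbf
    have hby : C.y b = 1 := congrArg Prod.snd hbf
    have h1 := congrArg C.α (hKcomm a ha b hb)
    rw [C.α_mul, C.α_mul, hax, hay, hbx, hby] at h1
    have h2 : (1 : ZMod p) = 0 := by linear_combination h1
    exact one_ne_zero h2
  by_cases hx : ∃ k ∈ K, C.x k ≠ 0
  · obtain ⟨k, hk, hkx⟩ := hx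
    exact C.trivialOn_top hX hG hc hS (t := k) hkx (hKc.commute_lift hzK hk (C.commute_z k))
  · push Not at hx
    let f : K → ZMod p × ZMod p := fun k => (C.y k, C.α k)
    have hf : Function.Injective f := by
      rintro ⟨k, hk⟩ ⟨k', hk'⟩ hkk
      exact Subtype.ext (C.ext _ _ ((hx k hk).trans (hx k' hk').symm) (congrArg Prod.fst hkk)
        (congrArg Prod.snd hkk))
    have hsurj := (hf.bijective_of_nat_card_le hKcard.ge).2
    have hKall : ∀ g, C.x g = 0 → g ∈ K := by
      intro g hg
      obtain ⟨⟨k, hk⟩, hkf⟩ := hsurj (C.y g, C.α g)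
      rwa [C.ext g k (hg.trans (hx k hk).symm) (congrArg Prod.fst hkf).symm
        (congrArg Prod.snd hkf).symm]
    -- By `conj_smul_iff` the element `(y, α) = (1, 0)` fixes `x₀` and `(-1, 1)` fixes `t⁻¹ • x₀`;
    -- their product is `z`.
    obtain ⟨⟨h₀, hh₀⟩, hf₀⟩ := hsurj (1, 0)
    obtain ⟨⟨h₁, hh₁⟩, hf₁⟩ := hsurj (-1, 1)
    have hy₀ : C.y h₀ = 1 := congrArg Prod.fst hf₀
    have hα₀ : C.α h₀ = 0 := congrArg Prod.snd hf₀
    have hy₁ : C.y h₁ = -1 := congrArg Prod.fst hf₁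
    have hα₁ : C.α h₁ = 1 := congrArg Prod.snd hf₁
    have hz : C.z = h₀ * h₁ := by
      refine C.ext _ _ ?_ ?_ ?_
      · rw [C.x_z, C.x_mul, hx _ hh₀, hx _ hh₁, add_zero]
      · rw [C.y_z, C.y_mul, hy₀, hy₁]
        ring
      · rw [C.α_z, C.α_mul, hx _ hh₀, hα₀, hα₁]
        ring
    refine C.trivialOn_top hX hG hc hS C.t_notMem_kernel ?_
    have hcz := C.commute_z C.t
    rw [hz] at hcz ⊢
    refine commute_lift_of_trivialOn_of_eq_mul hc hKc (fun k hk => hKall _ ?_) hh₀ hh₁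
      (v₀ := (1 : G) • x₀) (v₁ := C.t⁻¹ • x₀) ?_ ?_ hcz
    · rw [C.x_mul, C.x_mul, C.x_inv, hx k hk]
      ring
    · rw [C.conj_smul_iff (hx _ hh₀), hα₀, C.x_one, zero_mul]
    · rw [C.conj_smul_iff (hx _ hh₁), hα₁, C.x_inv, C.x_t, hy₁]
      ring

section Class

variable [MulAction.IsPretransitive G X]

/-- The coordinate `x` on the `G`-set `X`. -/
def pointX (v : X) : ZMod p := C.x (MulAction.exists_smul_eq G x₀ v).choose

theorem pointX_smul_base (g : G) : C.pointX (g • x₀) = C.x g := by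
  have h := (MulAction.exists_smul_eq G x₀ (g • x₀)).choose_spec
  have h1 : (g⁻¹ * (MulAction.exists_smul_eq G x₀ (g • x₀)).choose) • x₀ = x₀ := by
    rw [mul_smul, h, inv_smul_smul]
  have h2 := ((C.smul_eq_iff _).1 h1).1
  rw [C.x_mul, C.x_inv] at h2
  exact (neg_add_eq_zero.1 h2).symm

theorem pointX_smul (g : G) (v : X) : C.pointX (g • v) = C.x g + C.pointX v := by
  obtain ⟨h, rfl⟩ := MulAction.exists_smul_eq G x₀ v
  rw [← mul_smul, C.pointX_smul_base, C.pointX_smul_base, C.x_mul]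

/-- A class in `Ш²_ω` given by quadratic functions of the coordinate `x`. -/
def cls (g : G) (v : X) : AddCircle (1 : ℚ) :=
  zmodToCircle p (C.α g * C.pointX v - C.y g * (C.pointX v ^ 2 * 2⁻¹))

/-- Translating the point by `g⁻¹` in the quadratic term produces the cross term `y h * x g * pointX
v`, exactly the failure of `α` to be additive. The other new terms do not depend on the point.
Halving uses that `p` is odd. -/
theorem cls_isProjCocycle (hp2 : 2 < p) : IsProjCocycle C.cls := by
  intro g h
  have h2 : (2 : ZMod p) * 2⁻¹ = 1 := by
    refine mul_inv_cancel₀ fun h => ?_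
    have h3 : ((2 : ℕ) : ZMod p) = 0 := by exact_mod_cast h
    rw [ZMod.natCast_eq_zero_iff] at h3
    exact absurd (Nat.le_of_dvd two_pos h3) (by omega)
  refine ⟨zmodToCircle p (C.α h * C.x g + C.y h * (C.x g ^ 2 * 2⁻¹)), fun v => ?_⟩
  rw [cls, cls, cls, ← map_add, ← map_add]
  congr 1
  rw [C.pointX_smul, C.x_inv, C.α_mul, C.y_mul]
  linear_combination (-C.y h * C.x g * C.pointX v) * h2

/-- If `y h ≠ 0`, the fixed points of `h` share one coordinate `pointX`. If `y h = 0`, a fixed point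
forces `α h = 0` and the value is zero. -/
theorem cls_constOnFixed : ConstOnFixed C.cls := by
  intro h v v' hv hv'
  have hx : C.x h = 0 := by
    have := C.pointX_smul h v
    rw [hv] at this
    exact left_eq_add.1 (by rw [add_comm]; exact this)
  obtain ⟨g, rfl⟩ := MulAction.exists_smul_eq G x₀ v
  obtain ⟨g', rfl⟩ := MulAction.exists_smul_eq G x₀ v'
  rw [C.conj_smul_iff hx] at hv hv'
  rw [cls, cls, C.pointX_smul_base, C.pointX_smul_base]
  by_cases hy : C.y h = 0
  · rw [hy, mul_zero] at hv
    rw [hv, hy]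
    simp
  · have : C.x g = C.x g' := mul_right_cancel₀ hy (hv.symm.trans hv')
    rw [this]

theorem cls_hasLiftCommutator : HasLiftCommutator C.cls C.t C.z (zmodToCircle p (-1)) := by
  intro v
  rw [cls, cls, cls, cls, ← map_add, ← map_add, ← map_add]
  congr 1
  rw [C.pointX_smul, C.pointX_smul, C.x_inv, C.x_inv, C.x_z, C.x_t, C.y_z, C.α_z, C.α_t, C.y_t]
  ring

end Class

variable [Finite G] [MulAction.IsPretransitive G X] [FaithfulSMul G X]

theorem sha2_eq_bot (C : HeisChart p G x₀) (hX : Nat.card X = p ^ 2) (hG : IsPGroup p G)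
    {𝒟 : Set (Subgroup G)}
    (h𝒟 : IsAdmissible 𝒟) (hD : ∃ D ∈ 𝒟, ContainsCpSq p D) :
    sha2 𝒟 (chevalleyJ (MulAction.stabilizer G x₀)) = ⊥ := by
  obtain ⟨D, hD𝒟, hD⟩ := hD
  rw [eq_bot_iff]
  intro v hv
  obtain ⟨c, hc⟩ := exists_represents x₀ v
  rw [hc.mem_sha2_iff] at hv
  rw [Submodule.mem_bot, hc.eq_zero_iff]
  exact C.trivialOn_top_of_containsCpSq hX hG hc.isProjCocycle
    (constOnFixed_of_isAdmissible h𝒟 hv) hD (hv D hD𝒟)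

/-- The commutator of the lifts of `t` and `z` is additive, killed by `p`, and detects zero on `Ш²`.
It equals `-1/p` on the class of `cls`, which lies in `Ш²` because all members of `𝒟` are cyclic of
order dividing `p`. So this class is a generator of order `p`. -/
theorem nonempty_sha2_equiv (C : HeisChart p G x₀) (hp2 : 2 < p) (hX : Nat.card X = p ^ 2)
    (hG : IsPGroup p G)
    (hexp : ∀ g : G, g ^ p = 1) {𝒟 : Set (Subgroup G)} (h𝒟 : IsAdmissible 𝒟)
    (hD : ¬ ∃ D ∈ 𝒟, ContainsCpSq p D) :
    Nonempty (sha2 𝒟 (chevalleyJ (MulAction.stabilizer G x₀)) ≃+ ZMod p) := by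
  have : Nonempty X := ⟨x₀⟩
  obtain ⟨w, hw⟩ := (C.cls_isProjCocycle hp2).exists_represents x₀
  have hwmem : w ∈ sha2 𝒟 (chevalleyJ (MulAction.stabilizer G x₀)) := by
    rw [hw.mem_sha2_iff]
    intro D hD'
    obtain ⟨g, rfl⟩ := exists_eq_zpowers_of_not_containsCpSq hG hexp D fun h => hD ⟨D, hD', h⟩
    exact C.cls_constOnFixed.trivialOn_zpowers (C.cls_isProjCocycle hp2) hp.out (hexp g)
  have hzero : ∀ v ∈ sha2 𝒟 (chevalleyJ (MulAction.stabilizer G x₀)), ∀ c,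
      Represents x₀ v c → HasLiftCommutator c C.t C.z 0 → v = 0 := by
    intro v hv c hc h0
    rw [hc.mem_sha2_iff] at hv
    rw [hc.eq_zero_iff]
    exact C.trivialOn_top hX hG hc.isProjCocycle (constOnFixed_of_isAdmissible h𝒟 hv)
      C.t_notMem_kernel ((hasLiftCommutator_zero_iff (C.commute_z C.t)).1 h0)
  have hw0 : w ≠ 0 := by
    intro h0
    have h1 := (hasLiftCommutator_zero_iff (C.commute_z C.t)).2
      (((hw.eq_zero_iff).1 h0).commute_lift trivial trivial (C.commute_z C.t))
    have h2 := C.cls_hasLiftCommutator x₀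
    rw [h1 x₀, add_right_inj, map_neg] at h2
    exact zmodToCircle_one_ne_zero (neg_eq_zero.1 h2.symm)
  have hpw : p • w = 0 := by
    refine hzero _ (nsmul_mem hwmem p) _ (hw.nsmul p) ?_
    have h1 := C.cls_hasLiftCommutator.nsmul p
    rwa [← map_nsmul, nsmul_eq_mul, ZMod.natCast_self, zero_mul, map_zero] at h1
  have hgen : ∀ v ∈ sha2 𝒟 (chevalleyJ (MulAction.stabilizer G x₀)),
      ∃ k : ℕ, v + k • w = 0 := by
    intro v hv
    obtain ⟨c, hc⟩ := exists_represents x₀ v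
    obtain ⟨a, hpa, ha⟩ := exists_hasLiftCommutator hc.isProjCocycle (C.commute_z C.t)
      (hexp C.z)
    obtain ⟨k, rfl⟩ := exists_nsmul_of_nsmul_eq_zero hpa
    have h1 := ha.add (C.cls_hasLiftCommutator.nsmul k)
    rw [map_neg, smul_neg, add_neg_cancel] at h1
    exact ⟨k, hzero _ (add_mem hv (nsmul_mem hwmem k)) _ (hc.add (hw.nsmul k)) h1⟩
  let w' : sha2 𝒟 (chevalleyJ (MulAction.stabilizer G x₀)) := ⟨w, hwmem⟩
  have htop : AddSubgroup.zmultiples w' = ⊤ := by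
    rw [eq_top_iff]
    rintro ⟨v, hv⟩ -
    obtain ⟨k, hk⟩ := hgen v hv
    have h1 : (⟨v, hv⟩ : sha2 𝒟 (chevalleyJ (MulAction.stabilizer G x₀))) = -(k • w') :=
      Subtype.ext (eq_neg_of_add_eq_zero_left hk)
    rw [h1]
    exact neg_mem (nsmul_mem (AddSubgroup.mem_zmultiples w') k)
  have hord : addOrderOf w' = p :=
    addOrderOf_eq_prime (Subtype.ext hpw) fun h => hw0 (congrArg Subtype.val h)
  have hcard : Nat.card (sha2 𝒟 (chevalleyJ (MulAction.stabilizer G x₀))) = p := by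
    rw [← hord, ← Nat.card_zmultiples, htop]
    exact (Nat.card_congr (Equiv.Set.univ _)).symm
  have hcyc : IsAddCyclic (sha2 𝒟 (chevalleyJ (MulAction.stabilizer G x₀))) :=
    ⟨w', fun v => AddSubgroup.mem_zmultiples_iff.1 (htop ▸ AddSubgroup.mem_top v)⟩
  have e := zmodAddCyclicAddEquiv hcyc
  rw [hcard] at e
  exact ⟨e.symm⟩

end HeisChart

theorem equiv_of_sha2Omega_ne_bot {p : ℕ} [hp : Fact p.Prime] {G : Type} [Group G] [Finite G]
    {X : Type} [MulAction G X] [MulAction.IsPretransitive G X] [FaithfulSMul G X]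
    (hX : Nat.card X = p ^ 2) (hG : IsPGroup p G) (x₀ : X)
    (h : sha2Omega (chevalleyJ (MulAction.stabilizer G x₀)) ≠ ⊥) :
    Nonempty (G ≃* Multiplicative (ZMod p) × Multiplicative (ZMod p)) ∨
      Nonempty (G ≃* heisenberg p) := by
  obtain ⟨v, hv, hv0⟩ := (Submodule.ne_bot_iff _).1 h
  obtain ⟨c, hc⟩ := exists_represents x₀ v
  have hv' := (hc.mem_sha2_iff _).1 hv
  have hS : ConstOnFixed c := constOnFixed_of_trivialOn_zpowers fun g => hv' _ (by
    change IsCyclic _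
    infer_instance)
  have hnt : ¬ TrivialOn ⊤ c := fun h => hv0 (hc.eq_zero_iff.2 h)
  obtain ⟨N, hN⟩ := exists_isBlockKernel hX hG x₀
  have hexp : ∀ g : G, g ^ p = 1 := by
    intro g
    by_cases hg : g ∈ N
    · exact hN.pow_eq_one hG hg
    · by_contra hgp
      exact hnt (hN.trivialOn_top_of_pow_ne_one hG x₀ hc.isProjCocycle hS hg hgp)
  refine (exists_chart hX hG hexp x₀ ?_).1
  by_contra hlt
  exact hnt (hN.trivialOn_top_of_lt_card_stabilizer hG x₀ hc.isProjCocycle hS (not_le.1 hlt))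

end

theorem mainTheorem4 (p : ℕ) (hp : p.Prime) (hp2 : 2 < p) :
    -- the groups `P'_1` and `P'_2` are `(C_p)²` and the Heisenberg group
    Nonempty (PPrime p 1 ≃* Multiplicative (ZMod p) × Multiplicative (ZMod p)) ∧
    Nonempty (PPrime p 2 ≃* heisenberg p) ∧
    ∀ (G : Subgroup (Equiv.Perm (ZMod (p ^ 2)))),
      MulAction.IsPretransitive G (ZMod (p ^ 2)) → IsPGroup p G →
      ∀ (H : Subgroup G), (∃ i : ZMod (p ^ 2), H = MulAction.stabilizer G i) →
        -- (i)
        (sha2Omega (chevalleyJ H) ≠ ⊥ →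
          ∃ n : ℕ, (n = 1 ∨ n = 2) ∧ Nonempty (G ≃* PPrime p n)) ∧
        -- (ii)
        ((∃ n : ℕ, (n = 1 ∨ n = 2) ∧ Nonempty (G ≃* PPrime p n)) →
          ∀ 𝒟 : Set (Subgroup G), IsAdmissible 𝒟 →
            ((∃ D ∈ 𝒟, ContainsCpSq p D) → sha2 𝒟 (chevalleyJ H) = ⊥) ∧
            ((¬ ∃ D ∈ 𝒟, ContainsCpSq p D) →
              Nonempty (sha2 𝒟 (chevalleyJ H) ≃+ ZMod p))) := by
  have : Fact p.Prime := ⟨hp⟩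
  obtain ⟨e₁⟩ := nonempty_PPrime_one_equiv hp2
  obtain ⟨e₂⟩ := nonempty_PPrime_two_equiv hp2
  refine ⟨⟨e₁⟩, ⟨e₂⟩, ?_⟩
  rintro G htr hG _ ⟨i, rfl⟩
  have hX : Nat.card (ZMod (p ^ 2)) = p ^ 2 := Nat.card_zmod _
  have : NeZero (p ^ 2) := ⟨pow_ne_zero 2 hp.ne_zero⟩
  refine ⟨fun h => ?_, ?_⟩
  · rcases equiv_of_sha2Omega_ne_bot hX hG i h with ⟨⟨e⟩⟩ | ⟨⟨e⟩⟩
    · exact ⟨1, Or.inl rfl, ⟨e.trans e₁.symm⟩⟩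
    · exact ⟨2, Or.inr rfl, ⟨e.trans e₂.symm⟩⟩
  · rintro ⟨n, hn, ⟨e⟩⟩ 𝒟 h𝒟
    have hcard := card_eq_mul_card_stabilizer (G := G) hX i
    -- The isomorphism type enters only through the exponent and the order of `G`; the latter
    -- determines the order of the stabilizer.
    have hG' : (∀ g : G, g ^ p = 1) ∧ Nat.card (MulAction.stabilizer G i) ≤ p := by
      rcases hn with rfl | rfl
      · let f := e.trans e₁
        refine ⟨fun g => f.injective (by rw [map_pow, map_one, cpSq_pow_prime]), ?_⟩
        rw [Nat.card_congr f.toEquiv, card_cpSq] at hcard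
        have : p ^ 2 * 1 = p ^ 2 * Nat.card (MulAction.stabilizer G i) := by rw [← hcard, mul_one]
        rw [← Nat.eq_of_mul_eq_mul_left (pow_pos hp.pos 2) this]
        exact hp.one_le
      · let f := e.trans e₂
        refine ⟨fun g => f.injective (by rw [map_pow, map_one, heisenberg_pow_prime hp hp2]), ?_⟩
        rw [Nat.card_congr f.toEquiv, card_heisenberg] at hcard
        have : p ^ 2 * p = p ^ 2 * Nat.card (MulAction.stabilizer G i) := by rw [← hcard]; ring
        rw [← Nat.eq_of_mul_eq_mul_left (pow_pos hp.pos 2) this]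
    obtain ⟨C⟩ := (exists_chart hX hG hG'.1 i hG'.2).2
    exact ⟨C.sha2_eq_bot hX hG h𝒟, C.nonempty_sha2_equiv hp2 hX hG hG'.1 h𝒟⟩
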